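/- For an integer $n\ge 2$ and $\mathbf k=(k_1,\dots,k_n)\in\{2,3,\dots\}^n$, let $A=\prod_{i=1}^n\{1,\dots,k_i\}$ be the set of action profiles. An ordinal game consists of a complete and transitive binary relation $\succsim_i$ on $A$ for each player $i\in\{1,\dots,n\}$; write $\succ_i$ for its asymmetric part. The game is generic if for every $i$ and all distinct $a,a'\in A$ that differ only in the $i$th coordinate, $a\succ_i a'$ or $a'\succ_i a$. Let $\mathcal G(n,\mathbf k)$ be the (finite) set of generic games. An action $a_i$ of player $i$ is a best response to $a_{-i}$ if $(a_i,a_{-i})\succsim_i(x,a_{-i})$ for all $x\in\{1,\dots,k_i\}$, and $a\in A$ is a pure Nash equilibrium if $a_i$ is a best response to $a_{-i}$ for every $i$. The best-response graph is the directed graph on $A$ with an edge $a\to b$ if and only if there is a player $i$ such that $a_{-i}=b_{-i}$, $b_i$ is a best response to $a_{-i}$, and $b\succ_i a$. A sink is a vertex with no outgoing edge. A game is connected if its best-response graph has at least one sink and every non-sink can reach every sink along a directed path. **Theorem.** There exist constants $c>0$ and $\delta>0$ such that for all integers $n\ge 2$ and all $\mathbf k\in\{2,3,\dots\}^n$ with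 $\max_i k_i\le \delta\sqrt{n/\log n}$, $$\frac{|\{g\in\mathcal G(n,\mathbf k): g\text{ is connected}\}|}{|\{g\in\mathcal G(n,\mathbf k): g\text{ has a pure Nash equilibrium}\}|}\ \ge\ 1-e^{-cn}.$$ -/

import Mathlib

/-- Action profiles: player `i` chooses an action from a set with `k i` elements. -/
abbrev Profile {n : ℕ} (k : Fin n → ℕ) : Type := (i : Fin n) → Fin (k i)

/-- An ordinal game with player set `Fin n` and action sets `Fin (k i)`: each player has a complete
and transitive weak preference relation on action profiles.
`g.pref i a b` says that player `i` weakly prefers `a` to `b`. -/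
@[ext]
structure OrdinalGame {n : ℕ} (k : Fin n → ℕ) where
  pref : Fin n → Profile k → Profile k → Prop
  complete : ∀ i a b, pref i a b ∨ pref i b a
  transitive : ∀ i a b c, pref i a b → pref i b c → pref i a c

namespace OrdinalGame

variable {n : ℕ} {k : Fin n → ℕ}

/-- There are only finitely many ordinal games with given action sets. -/
instance : Finite (OrdinalGame k) :=
  Finite.of_injective (fun g : OrdinalGame k => g.pref) fun _ _ h => OrdinalGame.ext h

/-- Strict preference: the asymmetric part of the preference relation. -/
def StrictPref (g : OrdinalGame k) (i : Fin n) (a b : Profile k) : Prop :=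
  g.pref i a b ∧ ¬ g.pref i b a

/-- The action `x` of player `i` is a best response to the actions of the other players in `a`
(the `i`-th coordinate of `a` is irrelevant). -/
def IsBestResponse (g : OrdinalGame k) (i : Fin n) (x : Fin (k i)) (a : Profile k) : Prop :=
  ∀ y : Fin (k i), g.pref i (Function.update a i x) (Function.update a i y)

/-- Pure Nash equilibria. -/
def IsPureNash (g : OrdinalGame k) (a : Profile k) : Prop :=
  ∀ i, g.IsBestResponse i (a i) a

/-- The game has at least one pure Nash equilibrium. -/
def HasPureNash (g : OrdinalGame k) : Prop :=
  ∃ a, g.IsPureNash a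

/-- The best-response graph: there is an edge from `a` to `b` if some player `i` moves from `a i` to
`b i`, which is a best response, and strictly gains by it. -/
def bestResponseGraph (g : OrdinalGame k) : Digraph (Profile k) where
  Adj a b := ∃ i, (∀ j, j ≠ i → a j = b j) ∧ g.IsBestResponse i (b i) a ∧ g.StrictPref i b a

/-- Generic games: no player is indifferent between two profiles that differ only in
that player's action. -/
def IsGeneric (g : OrdinalGame k) : Prop :=
  ∀ i, ∀ a b : Profile k, a ≠ b → (∀ j, j ≠ i → a j = b j) →
    g.StrictPref i a b ∨ g.StrictPref i b a

end OrdinalGame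

/-- A sink of a directed graph is a vertex without outgoing edges. -/
def IsSink {V : Type*} (G : Digraph V) (v : V) : Prop :=
  ∀ w, ¬ G.Adj v w

/-- `v` can reach `w` along a (possibly empty) directed path. -/
def CanReach {V : Type*} (G : Digraph V) (v w : V) : Prop :=
  Relation.ReflTransGen G.Adj v w

/-- A game is connected if its best-response graph has a sink and every non-sink can reach
every sink. -/
def OrdinalGame.IsConnected {n : ℕ} {k : Fin n → ℕ} (g : OrdinalGame k) : Prop :=
  (∃ v, IsSink g.bestResponseGraph v) ∧
    ∀ v w, ¬ IsSink g.bestResponseGraph v → IsSink g.bestResponseGraph w →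
      CanReach g.bestResponseGraph v w

/-! In a generic game the best-response graph depends only on the unique best reply of each player
on each line of profiles. Shifting actions cyclically along lines permutes the generic games, so
these replies are independent and uniform (`ncard_isGeneric_and`), and the theorem becomes a
statement about a product space. Write N for the number of profiles and κ for the largest action
set.

Fix a profile w. Being a sink involves only the replies on lines through w and has probability 1/N.
Given that, it suffices that every non-sink v reaches some profile on a line through w, an event
controlled by the other replies (`prob_sink_and_not_reach_le`). If this fails with probability at
most c for every w, summing over w costs N · c/N = c. A second moment bound shows that a sink exists
with probability at least 1/2, so conditioning at most doubles the error.

To connect v to w, split the players into four classes. Outside a rare event no two adjacent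
profiles both have few improving players (`prob_exists_adjacent_outDegree_le`), so v, or a profile
one step away, has many in some class. Each improving move starts an independent exploration in a
second class. One exploration reaches exponentially many profiles by repeated doubling
(`IsExploration.exists_large`), and the chance that all fail beats the union bound over v. The other
two classes give the same exploration backwards from neighbours of w, where no union bound is
needed. The two large sets lie in transverse subcubes; disjoint pairs of their members are joined
through hybrid profiles by independent greedy descents, each succeeding with probability at least
18^(-κ) (`le_prob_descends`, `inv_pow_le_prob_one_sub_pow` in its product form,
`prob_not_connect_le`).

About κ + log n doublings are needed, each using about κ log n directions for the backward search;
fitting them into n directions is what requires κ² log n to be at most a small multiple of n. -/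

namespace UniformProduct

open Finset

/-! ### Finite uniform probability, independence and resampling on product spaces. -/

section Mean

variable {Ω : Type*} [Fintype Ω]

/-- The expectation of `f` under the uniform distribution on a finite type. -/
noncomputable def mean (f : Ω → ℝ) : ℝ := (∑ ω, f ω) / Fintype.card Ω

open Classical in
/-- The probability of the event `E` under the uniform distribution on a finite type. -/
noncomputable def prob (E : Ω → Prop) : ℝ := mean fun ω => if E ω then 1 else 0

theorem mean_mono {f g : Ω → ℝ} (h : ∀ ω, f ω ≤ g ω) : mean f ≤ mean g := by
  unfold mean
  gcongr
  exact h _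

theorem mean_add (f g : Ω → ℝ) : mean (fun ω => f ω + g ω) = mean f + mean g := by
  simp [mean, sum_add_distrib, add_div]

theorem mean_const_mul (c : ℝ) (f : Ω → ℝ) : mean (fun ω => c * f ω) = c * mean f := by
  simp [mean, ← mul_sum, mul_div_assoc]

theorem mean_sum {ι : Type*} (I : Finset ι) (f : ι → Ω → ℝ) :
    mean (fun ω => ∑ i ∈ I, f i ω) = ∑ i ∈ I, mean (f i) := by
  simp only [mean, sum_div]
  rw [sum_comm]

theorem mean_const [Nonempty Ω] (c : ℝ) : mean (fun _ : Ω => c) = c := by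
  simp [mean]

theorem mean_nonneg {f : Ω → ℝ} (h : ∀ ω, 0 ≤ f ω) : 0 ≤ mean f :=
  div_nonneg (sum_nonneg fun ω _ => h ω) (Nat.cast_nonneg _)

theorem prob_nonneg (E : Ω → Prop) : 0 ≤ prob E :=
  mean_nonneg fun ω => by split_ifs <;> simp

theorem prob_mono {E F : Ω → Prop} (h : ∀ ω, E ω → F ω) : prob E ≤ prob F := by
  classical
  refine mean_mono fun ω => ?_
  by_cases hE : E ω
  · simp [hE, h ω hE]
  · simp only [hE, if_false]
    split_ifs <;> simp

theorem prob_congr {E F : Ω → Prop} (h : ∀ ω, E ω ↔ F ω) : prob E = prob F :=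
  le_antisymm (prob_mono fun ω => (h ω).1) (prob_mono fun ω => (h ω).2)

theorem prob_le_one (E : Ω → Prop) : prob E ≤ 1 := by
  classical
  unfold prob mean
  refine div_le_one_of_le₀ ?_ (Nat.cast_nonneg _)
  calc _ ≤ ∑ _ω : Ω, (1 : ℝ) := sum_le_sum fun ω _ => by split_ifs <;> simp
    _ = _ := by simp

theorem prob_or_le (E F : Ω → Prop) : prob (fun ω => E ω ∨ F ω) ≤ prob E + prob F := by
  classical
  unfold prob
  rw [← mean_add]
  refine mean_mono fun ω => ?_
  by_cases hE : E ω <;> by_cases hF : F ω <;> simp [hE, hF]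

theorem prob_exists_le {ι : Type*} (I : Finset ι) (E : ι → Ω → Prop) :
    prob (fun ω => ∃ i ∈ I, E i ω) ≤ ∑ i ∈ I, prob (E i) := by
  classical
  unfold prob
  rw [← mean_sum]
  refine mean_mono fun ω => ?_
  split_ifs with h
  · obtain ⟨i, hi, hE⟩ := h
    calc (1 : ℝ) = if E i ω then 1 else 0 := by simp [hE]
      _ ≤ _ := single_le_sum (f := fun i => if E i ω then (1 : ℝ) else 0)
        (fun i _ => by split_ifs <;> simp) hi
  · exact sum_nonneg fun i _ => by split_ifs <;> simp

theorem prob_not [Nonempty Ω] (E : Ω → Prop) : prob (fun ω => ¬ E ω) = 1 - prob E := by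
  classical
  have : prob (fun ω => ¬ E ω) + prob E = 1 := by
    unfold prob
    rw [← mean_add]
    refine Eq.trans ?_ (mean_const (Ω := Ω) 1)
    congr 1
    ext ω
    by_cases hE : E ω <;> simp [hE]
  linarith

theorem prob_and_add_and_not (E F : Ω → Prop) :
    prob (fun ω => E ω ∧ F ω) + prob (fun ω => E ω ∧ ¬ F ω) = prob E := by
  classical
  unfold prob
  rw [← mean_add]
  congr 1
  ext ω
  by_cases hE : E ω <;> by_cases hF : F ω <;> simp [hE, hF]

theorem prob_of_forall_not {E : Ω → Prop} (h : ∀ ω, ¬ E ω) : prob E = 0 := by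
  simp [prob, mean, h]

theorem prob_of_forall [Nonempty Ω] {E : Ω → Prop} (h : ∀ ω, E ω) : prob E = 1 := by
  simp [prob, mean, h]

end Mean

section DependsOn

variable {Q : Type*} {β : Q → Type*}

theorem piecewise_congr {S T : Set Q} [DecidablePred (· ∈ S)] (h : T ⊆ S) {E : (∀ q, β q) → Prop}
    (hE : DependsOn E T) (ω₁ ω₂ : ∀ q, β q) : E (S.piecewise ω₁ ω₂) = E ω₁ :=
  hE fun q hq => by simp [h hq]

theorem piecewise_congr_right {S T : Set Q} [DecidablePred (· ∈ S)] (h : Disjoint S T)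
    {γ : Type*} {E : (∀ q, β q) → γ}
    (hE : DependsOn E T) (ω₁ ω₂ : ∀ q, β q) : E (S.piecewise ω₁ ω₂) = E ω₂ :=
  hE fun q hq => by simp [Set.disjoint_right.1 h hq]

theorem dependsOn_forall_mem {ι : Type*} {I : Finset ι} {E : ι → (∀ q, β q) → Prop}
    {L : ι → Set Q} (hE : ∀ i ∈ I, DependsOn (E i) (L i)) :
    DependsOn (fun ω => ∀ i ∈ I, E i ω) (⋃ i ∈ I, L i) := by
  intro ω ω' h
  refine propext (forall₂_congr fun i hi => ?_)
  rw [hE i hi fun q hq => h q (Set.mem_biUnion hi hq)]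

theorem dependsOn_coord (q : Q) (P : β q → Prop) :
    DependsOn (fun ω : ∀ q, β q => P (ω q)) {q} := by
  intro ω ω' h
  simp only
  rw [h q rfl]

end DependsOn

variable {Q : Type*} [Fintype Q] [DecidableEq Q] {β : Q → Type*} [∀ q, Fintype (β q)]
  [∀ q, Nonempty (β q)]

open Classical in
/-- Exchanging the coordinates outside `S` between two points of a product. -/
noncomputable def exchange (S : Set Q) :
    ((∀ q, β q) × (∀ q, β q)) ≃ ((∀ q, β q) × (∀ q, β q)) where
  toFun p := (S.piecewise p.1 p.2, S.piecewise p.2 p.1)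
  invFun p := (S.piecewise p.1 p.2, S.piecewise p.2 p.1)
  left_inv p := by
    ext q <;> by_cases h : q ∈ S <;> simp [h]
  right_inv p := by
    ext q <;> by_cases h : q ∈ S <;> simp [h]

open Classical in
/-- Resampling the coordinates outside `S` does not change expectations. -/
theorem mean_piecewise (S : Set Q) (f : (∀ q, β q) → ℝ) :
    mean f = mean fun ω₁ => mean fun ω₂ => f (S.piecewise ω₁ ω₂) := by
  have key : ∑ ω₁ : ∀ q, β q, ∑ ω₂ : ∀ q, β q, f (S.piecewise ω₁ ω₂) =
      Fintype.card (∀ q, β q) * ∑ ω, f ω := by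
    rw [← Fintype.sum_prod_type' (f := fun ω₁ ω₂ => f (S.piecewise ω₁ ω₂))]
    rw [← (exchange S).sum_comp]
    -- `exchange` is an involution, so mixing an exchanged pair recovers its first component.
    have : ∀ p : (∀ q, β q) × (∀ q, β q),
        f (S.piecewise ((exchange S) p).1 ((exchange S) p).2) = f p.1 := by
      intro p
      congr 1
      exact congrArg Prod.fst ((exchange S).left_inv p)
    simp only [this]
    rw [Fintype.sum_prod_type, sum_comm]
    simp
  have hcard : (Fintype.card (∀ q, β q) : ℝ) ≠ 0 := by
    exact_mod_cast Fintype.card_ne_zero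
  unfold mean
  rw [← sum_div, key]
  field_simp

open Classical in
theorem prob_piecewise (S : Set Q) (E : (∀ q, β q) → Prop) :
    prob E = mean fun ω₁ => prob fun ω₂ => E (S.piecewise ω₁ ω₂) :=
  mean_piecewise S _

-- Conditioning in the form used throughout: freeze the coordinates in `S` at `ω₁`, and bound the
-- probability over the remaining ones uniformly in `ω₁`.
open Classical in
theorem prob_le_of_forall_piecewise (S : Set Q) {E : (∀ q, β q) → Prop} {c : ℝ}
    (h : ∀ ω₁, prob (fun ω₂ => E (S.piecewise ω₁ ω₂)) ≤ c) : prob E ≤ c := by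
  rw [prob_piecewise S E, ← mean_const (Ω := ∀ q, β q) c]
  exact mean_mono h

theorem prob_and {S T : Set Q} (hST : Disjoint S T) {E F : (∀ q, β q) → Prop}
    (hE : DependsOn E S) (hF : DependsOn F T) :
    prob (fun ω => E ω ∧ F ω) = prob E * prob F := by
  classical
  rw [prob_piecewise S, mul_comm]
  unfold prob
  rw [← mean_const_mul]
  congr 1
  ext ω₁
  simp only [piecewise_congr subset_rfl hE, piecewise_congr_right hST hF]
  by_cases h : E ω₁
  · simp [h]
  · simp only [h, false_and, if_false, mul_zero]
    exact mean_const 0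

theorem prob_forall_mem {ι : Type*} {I : Finset ι} {E : ι → (∀ q, β q) → Prop}
    {L : ι → Set Q} (hE : ∀ i ∈ I, DependsOn (E i) (L i))
    (hL : ∀ i ∈ I, ∀ j ∈ I, i ≠ j → Disjoint (L i) (L j)) :
    prob (fun ω => ∀ i ∈ I, E i ω) = ∏ i ∈ I, prob (E i) := by
  classical
  induction I using Finset.induction_on with
  | empty => simpa using prob_of_forall (Ω := ∀ q, β q) (fun _ => True.intro)
  | insert a I ha ih =>
    rw [prod_insert ha, ← ih (fun i hi => hE i (mem_insert_of_mem hi))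
      (fun i hi j hj => hL i (mem_insert_of_mem hi) j (mem_insert_of_mem hj))]
    rw [← prob_and (S := L a) (T := ⋃ i ∈ I, L i) _ (hE a (mem_insert_self _ _))
      (dependsOn_forall_mem fun i hi => hE i (mem_insert_of_mem hi))]
    · refine prob_congr fun ω => ?_
      simp
    · simp only [Set.disjoint_iUnion_right]
      intro i hi
      exact hL a (mem_insert_self _ _) i (mem_insert_of_mem hi) (by rintro rfl; exact ha hi)

/-- Swapping two values of one coordinate is a bijection of the product, so all values are equally
likely. -/
theorem prob_coord_eq (q : Q) (c : β q) :
    prob (fun ω : ∀ q, β q => ω q = c) = 1 / Fintype.card (β q) := by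
  classical
  have hcard : ∀ c' : β q, prob (fun ω : ∀ q, β q => ω q = c') =
      prob (fun ω : ∀ q, β q => ω q = c) := by
    intro c'
    unfold prob mean
    congr 1
    let e : (∀ q, β q) ≃ (∀ q, β q) := Equiv.piCongrRight fun q' =>
      if h : q' = q then by subst h; exact Equiv.swap c c' else Equiv.refl _
    rw [← e.sum_comp]
    refine sum_congr rfl fun ω _ => ?_
    have : (e ω) q = Equiv.swap c c' (ω q) := by simp [e]
    simp only [this, Equiv.swap_apply_eq_iff, Equiv.swap_apply_right]
  have hsum : ∑ c' : β q, prob (fun ω : ∀ q, β q => ω q = c') = 1 := by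
    unfold prob
    rw [← mean_sum]
    simp [mean_const]
  rw [sum_congr rfl fun c' _ => hcard c'] at hsum
  have hc : (Fintype.card (β q) : ℝ) ≠ 0 := by exact_mod_cast Fintype.card_ne_zero
  rw [sum_const, card_univ, nsmul_eq_mul] at hsum
  field_simp
  linarith

end UniformProduct

/-! ### Best-response moves and exploration by doubling. -/

namespace BestResponse

open Finset UniformProduct

variable {n : ℕ} {k : Fin n → ℕ}

/-- A choice of best response for every player and every line of profiles; the line of player `i`
through `a` is represented by its member with `i`-th coordinate `0`. -/
abbrev Responses (k : Fin n → ℕ) : Type := (q : Fin n × Profile k) → Fin (k q.1)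

/-- The lines in a direction of `J` inside the subcube through `u` with directions `J`. -/
def lines (J : Finset (Fin n)) (u : Profile k) : Set (Fin n × Profile k) :=
  {q | q.1 ∈ J ∧ ∀ l ∉ J, q.2 l = u l}

theorem lines_subset {J J' : Finset (Fin n)} (h : J ⊆ J') {u v : Profile k}
    (huv : ∀ l ∉ J', u l = v l) : lines J u ⊆ lines J' v := fun _ hq =>
  ⟨h hq.1, fun l hl => (hq.2 l fun hl' => hl (h hl')).trans (huv l hl)⟩

theorem disjoint_lines {J J' : Finset (Fin n)} (h : Disjoint J J') (u v : Profile k) :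
    Disjoint (lines J u) (lines J' v) :=
  Set.disjoint_left.2 fun _ hq hq' => Finset.disjoint_left.1 h hq.1 hq'.1

theorem disjoint_lines_of_ne {J : Finset (Fin n)} {u v : Profile k} {l : Fin n} (hl : l ∉ J)
    (h : u l ≠ v l) : Disjoint (lines J u) (lines J v) :=
  Set.disjoint_left.2 fun _ hq hq' => h ((hq.2 l hl).symm.trans (hq'.2 l hl))

/-- The properties of a random relation on profiles, defined within subcubes, that are needed for
exploring it one group of directions at a time. -/
structure IsExploration (R : Responses k → Finset (Fin n) → Profile k → Profile k → Prop) :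
    Prop where
  refl : ∀ ω J a, R ω J a a
  trans : ∀ ω J a b c, R ω J a b → R ω J b c → R ω J a c
  mono : ∀ ω J J' a b, J ⊆ J' → R ω J a b → R ω J' a b
  eq_of_notMem : ∀ ω J a b l, R ω J a b → l ∉ J → b l = a l
  dependsOn : ∀ J a b, DependsOn (fun ω => R ω J a b) (lines J a)

theorem IsExploration.dependsOn_exists
    {R : Responses k → Finset (Fin n) → Profile k → Profile k → Prop} (hR : IsExploration R)
    (M : ℕ) (J : Finset (Fin n)) (u : Profile k) :
    DependsOn (fun ω => ∃ D : Finset (Profile k), M ≤ 2 * D.card ∧ ∀ z ∈ D, R ω J u z)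
      (lines J u) := by
  intro ω ω' h
  have : ∀ z, R ω J u z = R ω' J u z := fun z => hR.dependsOn J u z h
  simp only [this]

variable [∀ i, NeZero (k i)]

/-- The line of player `i` through `a`. -/
abbrev line (i : Fin n) (a : Profile k) : Fin n × Profile k := (i, Function.update a i 0)

theorem line_eq_line {i : Fin n} {a b : Profile k} :
    line i a = line i b ↔ ∀ j, j ≠ i → a j = b j := by
  constructor
  · intro h j hj
    have := congrFun (Prod.ext_iff.1 h).2 j
    simpa [hj] using this
  · intro h
    refine Prod.ext rfl (funext fun j => ?_)
    by_cases hj : j = i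
    · subst hj; simp
    · simp [hj, h j hj]

theorem line_mem_lines {J : Finset (Fin n)} {u a : Profile k} {i : Fin n} (hi : i ∈ J)
    (h : ∀ l ∉ J, a l = u l) : line i a ∈ lines J u := by
  refine ⟨hi, fun l hl => ?_⟩
  have : l ≠ i := by rintro rfl; exact hl hi
  simp [this, h l hl]

/-- The best response of player `i` at the profile `a`. -/
def reply (ω : Responses k) (i : Fin n) (a : Profile k) : Fin (k i) := ω (line i a)

/-- `Responses` also has coordinates at pairs that represent no line; `reply` never reads these
dummies, so it is constant along a line. -/
theorem reply_update (ω : Responses k) (i : Fin n) (a : Profile k) (x : Fin (k i)) :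
    reply ω i (Function.update a i x) = reply ω i a := by
  have h : Function.update (Function.update a i x) i 0 = Function.update a i 0 := by simp
  let f : Profile k → Fin (k i) := fun b => ω (i, b)
  exact congrArg f h

/-- Some player in `J` strictly improves by moving to the best response. -/
def Step (ω : Responses k) (J : Finset (Fin n)) (a b : Profile k) : Prop :=
  ∃ i ∈ J, reply ω i a ≠ a i ∧ b = Function.update a i (reply ω i a)

/-- Reachability by best-response moves of the players in `J`. -/
def Reach (ω : Responses k) (J : Finset (Fin n)) (a b : Profile k) : Prop :=
  Relation.ReflTransGen (Step ω J) a b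

theorem Step.eq_of_notMem {ω : Responses k} {J : Finset (Fin n)} {a b : Profile k}
    (h : Step ω J a b) {l : Fin n} (hl : l ∉ J) : b l = a l := by
  obtain ⟨i, hi, -, rfl⟩ := h
  exact Function.update_of_ne (by rintro rfl; exact hl hi) _ _

theorem Reach.eq_of_notMem {ω : Responses k} {J : Finset (Fin n)} {a b : Profile k}
    (h : Reach ω J a b) {l : Fin n} (hl : l ∉ J) : b l = a l := by
  induction h with
  | refl => rfl
  | tail _ h ih => rw [h.eq_of_notMem hl, ih]

theorem Reach.mono {ω : Responses k} {J J' : Finset (Fin n)} (hJ : J ⊆ J') {a b : Profile k}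
    (h : Reach ω J a b) : Reach ω J' a b :=
  Relation.ReflTransGen.mono (r := Step ω J) (p := Step ω J')
    (fun _ _ ⟨i, hi, h⟩ => ⟨i, hJ hi, h⟩) a b h

theorem Reach.trans {ω : Responses k} {J : Finset (Fin n)} {a b c : Profile k}
    (h : Reach ω J a b) (h' : Reach ω J b c) : Reach ω J a c :=
  Relation.ReflTransGen.trans h h'

theorem Step.reach {ω : Responses k} {J : Finset (Fin n)} {a b : Profile k}
    (h : Step ω J a b) : Reach ω J a b := Relation.ReflTransGen.single h

theorem Reach.congr {ω ω' : Responses k} {J : Finset (Fin n)} {a b : Profile k}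
    (hω : ∀ q ∈ lines J a, ω q = ω' q) (h : Reach ω J a b) : Reach ω' J a b := by
  induction h with
  | refl => exact Relation.ReflTransGen.refl
  | @tail c d hc hd ih =>
    refine ih.tail ?_
    obtain ⟨i, hi, hne, rfl⟩ := hd
    have : reply ω i c = reply ω' i c :=
      hω _ (line_mem_lines hi fun l hl => Reach.eq_of_notMem hc hl)
    exact ⟨i, hi, this ▸ hne, by rw [this]⟩

theorem dependsOn_reach (J : Finset (Fin n)) (a b : Profile k) :
    DependsOn (fun ω : Responses k => Reach ω J a b) (lines J a) := fun _ _ h =>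
  propext ⟨Reach.congr h, Reach.congr fun q hq => (h q hq).symm⟩

/-- A path by players in `J` never leaves its subcube, so the lines of the subcube can be described
from the endpoint as well as from the start. -/
theorem dependsOn_reach_right (J : Finset (Fin n)) (a b : Profile k) :
    DependsOn (fun ω : Responses k => Reach ω J b a) (lines J a) := by
  intro ω ω' h
  refine propext ⟨fun hr => hr.congr ?_, fun hr => hr.congr ?_⟩
  · exact fun q hq => h q (lines_subset subset_rfl (fun l hl => (hr.eq_of_notMem hl).symm) hq)
  · exact fun q hq => (h q (lines_subset subset_rfl (fun l hl => (hr.eq_of_notMem hl).symm) hq)).symm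

theorem prob_forall_line (K : Finset (Fin n)) (a : Profile k) (P : ∀ i, Fin (k i) → Prop) :
    prob (fun ω : Responses k => ∀ i ∈ K, P i (reply ω i a)) =
      ∏ i ∈ K, prob (fun ω : Responses k => P i (reply ω i a)) := by
  refine prob_forall_mem (E := fun i (ω : Responses k) => P i (reply ω i a))
    (L := fun i => {line i a}) (fun i _ =>
      dependsOn_coord (β := fun q : Fin n × Profile k => Fin (k q.1)) (line i a) (P i)) ?_
  intro i _ j _ hij
  simp [line, hij]

theorem prob_reply_eq (i : Fin n) (a : Profile k) (x : Fin (k i)) :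
    prob (fun ω : Responses k => reply ω i a = x) = 1 / (k i : ℝ) := by
  have := prob_coord_eq (β := fun q : Fin n × Profile k => Fin (k q.1)) (line i a) x
  simpa [reply] using this

theorem prob_reply_ne (i : Fin n) (a : Profile k) (x : Fin (k i)) :
    prob (fun ω : Responses k => reply ω i a ≠ x) = 1 - 1 / (k i : ℝ) := by
  rw [← prob_reply_eq i a x, ← prob_not]

theorem prob_forall_reply_eq (K : Finset (Fin n)) (a b : Profile k) :
    prob (fun ω : Responses k => ∀ i ∈ K, reply ω i a = b i) = ∏ i ∈ K, (1 / (k i : ℝ)) := by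
  rw [prob_forall_line K a fun i x => x = b i]
  exact prod_congr rfl fun i _ => prob_reply_eq i a (b i)

theorem prob_forall_reply_ne (K : Finset (Fin n)) (a b : Profile k) :
    prob (fun ω : Responses k => ∀ i ∈ K, reply ω i a ≠ b i) =
      ∏ i ∈ K, (1 - 1 / (k i : ℝ)) := by
  rw [prob_forall_line K a fun i x => x ≠ b i]
  exact prod_congr rfl fun i _ => prob_reply_ne i a (b i)

/-- Being stuck means that every player in `K` already plays a best reply at `a`. -/
theorem prob_forall_not_reach_le (hk : ∀ i, 2 ≤ k i) (K : Finset (Fin n)) (a : Profile k) :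
    prob (fun ω : Responses k => ¬ ∃ b, b ≠ a ∧ Reach ω K a b) ≤ (1 / 2) ^ K.card := by
  calc _ ≤ prob (fun ω : Responses k => ∀ i ∈ K, reply ω i a = a i) := by
        refine prob_mono fun ω h i hi => ?_
        by_contra hne
        refine h ⟨Function.update a i (reply ω i a), ?_, Step.reach ⟨i, hi, hne, rfl⟩⟩
        intro h'
        exact hne (by simpa using congrFun h' i)
    _ = ∏ i ∈ K, (1 / (k i : ℝ)) := prob_forall_reply_eq K a a
    _ ≤ ∏ _i ∈ K, (1 / 2 : ℝ) := by
        refine prod_le_prod (fun i _ => by positivity) fun i _ => ?_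
        have : (2 : ℝ) ≤ k i := by exact_mod_cast hk i
        gcongr
    _ = _ := by simp

theorem one_sub_one_div_le {m κ : ℕ} (hm : m ≤ κ) (h : 1 ≤ m) :
    1 - 1 / (m : ℝ) ≤ 1 - 1 / (κ : ℝ) := by
  have h1 : (1 : ℝ) ≤ m := by exact_mod_cast h
  have h2 : (m : ℝ) ≤ κ := by exact_mod_cast hm
  gcongr

theorem one_sub_one_div_nonneg {m : ℕ} : 0 ≤ 1 - 1 / (m : ℝ) := by
  rcases Nat.eq_zero_or_pos m with rfl | h
  · simp
  · have h1 : (1 : ℝ) ≤ m := by exact_mod_cast h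
    rw [sub_nonneg, div_le_one (by positivity)]
    exact h1

theorem prob_forall_reply_ne_le {κ : ℕ} (hk : ∀ i, k i ≤ κ) (K : Finset (Fin n))
    (a b : Profile k) :
    prob (fun ω : Responses k => ∀ i ∈ K, reply ω i a ≠ b i) ≤ (1 - 1 / (κ : ℝ)) ^ K.card := by
  rw [prob_forall_reply_ne, ← prod_const]
  exact prod_le_prod (fun i _ => one_sub_one_div_nonneg) fun i _ =>
    one_sub_one_div_le (hk i) (NeZero.one_le)

/-- If a single player in `K` has reply `a i`, any other profile on that line moves to `a`. Such a
reply may be as rare as 1/κ, so backward growth is slower than forward growth. -/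
theorem prob_forall_not_reach_right_le {κ : ℕ} (hk : ∀ i, 2 ≤ k i) (hκ : ∀ i, k i ≤ κ)
    (K : Finset (Fin n)) (a : Profile k) :
    prob (fun ω : Responses k => ¬ ∃ b, b ≠ a ∧ Reach ω K b a) ≤ (1 - 1 / (κ : ℝ)) ^ K.card := by
  refine le_trans (prob_mono fun ω h i hi heq => ?_) (prob_forall_reply_ne_le hκ K a a)
  have : Nontrivial (Fin (k i)) := Fin.nontrivial_iff_two_le.2 (hk i)
  obtain ⟨x, hx⟩ := exists_ne (a i)
  refine h ⟨Function.update a i x, ?_, Step.reach ⟨i, hi, ?_, ?_⟩⟩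
  · intro h'
    exact hx (by simpa using congrFun h' i)
  · rw [reply_update, heq]
    simpa using hx.symm
  · rw [reply_update, heq]
    simp

theorem isExploration_reach : IsExploration (k := k) Reach where
  refl _ _ _ := Relation.ReflTransGen.refl
  trans _ _ _ _ _ := Reach.trans
  mono _ _ _ _ _ h := Reach.mono h
  eq_of_notMem _ _ _ _ _ h hl := h.eq_of_notMem hl
  dependsOn := dependsOn_reach

theorem isExploration_reach_swap :
    IsExploration (k := k) fun ω J a b => Reach ω J b a where
  refl _ _ _ := Relation.ReflTransGen.refl
  trans _ _ _ _ _ h h' := h'.trans h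
  mono _ _ _ _ _ h := Reach.mono h
  eq_of_notMem _ _ _ _ _ h hl := (h.eq_of_notMem hl).symm
  dependsOn := dependsOn_reach_right

/-- Set aside `s` directions `K` and look there for one new profile `b`. On success, continue in `J
\ K` from both `u` and `b`: the two explorations cannot meet, and the lines they read are
independent of those read in `K`. Each round thus multiplies the expected size by at least `2 - q`.
-/
theorem IsExploration.exists_doubling
    {R : Responses k → Finset (Fin n) → Profile k → Profile k → Prop} (hR : IsExploration R)
    {q : ℝ} (hq1 : q ≤ 1) {s : ℕ}
    (hgrow : ∀ (K : Finset (Fin n)) (a : Profile k), K.card = s →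
      prob (fun ω => ¬ ∃ b, b ≠ a ∧ R ω K a b) ≤ q) (t : ℕ) (J : Finset (Fin n))
    (hJ : t * s ≤ J.card) :
    ∃ D : Responses k → Profile k → Finset (Profile k),
      (∀ u, DependsOn (fun ω => D ω u) (lines J u)) ∧ (∀ ω u, ∀ z ∈ D ω u, R ω J u z) ∧
      (∀ ω u, (D ω u).card ≤ 2 ^ t) ∧
      ∀ u, (2 - q) ^ t ≤ mean fun ω => ((D ω u).card : ℝ) := by
  classical
  induction t generalizing J with
  | zero =>
    refine ⟨fun _ u => {u}, fun u _ _ _ => rfl, ?_, ?_, ?_⟩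
    · intro ω u z hz
      rw [mem_singleton.1 hz]
      exact hR.refl _ _ _
    · simp
    · simp [mean_const]
  | succ t ih =>
    have hs : s ≤ J.card := le_trans (by nlinarith) hJ
    obtain ⟨K, hKJ, hK⟩ := exists_subset_card_eq hs
    have hcard : t * s ≤ (J \ K).card := by
      rw [card_sdiff_of_subset hKJ, hK]
      have : (t + 1) * s = t * s + s := by ring
      omega
    obtain ⟨D, hdep, hD, hle, hmean⟩ := ih (J \ K) hcard
    let P : Responses k → Profile k → Profile k → Prop := fun ω u b => b ≠ u ∧ R ω K u b
    -- The predicate selecting the second starting point is separate from `ω`, so that the selection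
    -- can be frozen while the continuation is resampled.
    let N : (Profile k → Prop) → Responses k → Finset (Profile k) := fun p ω =>
      if h : ∃ b, p b then D ω h.choose else ∅
    have hPdep : ∀ u, DependsOn (fun ω => P ω u) (lines K u) := by
      intro u ω ω' h
      funext b
      exact congrArg (b ≠ u ∧ ·) (hR.dependsOn K u b h)
    have hb : ∀ ω u b, P ω u b → ∀ l ∉ K, b l = u l := fun ω u b h l hl =>
      hR.eq_of_notMem ω K u b l h.2 hl
    have hbJ : ∀ ω u b, P ω u b → ∀ l ∉ J, b l = u l := fun ω u b h l hl =>
      hb ω u b h l fun hl' => hl (hKJ hl')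
    have hN : ∀ ω ω' u, (∀ q ∈ lines J u, ω q = ω' q) → N (P ω u) ω = N (P ω u) ω' := by
      intro ω ω' u h
      simp only [N]
      split_ifs with hex
      · exact hdep _ fun q hq => h q
          (lines_subset sdiff_subset (hbJ ω u _ hex.choose_spec) hq)
      · rfl
    refine ⟨fun ω u => D ω u ∪ N (P ω u) ω, ?_, ?_, ?_, ?_⟩
    · intro u ω ω' h
      have h1 : D ω u = D ω' u := hdep u fun q hq =>
        h q (lines_subset sdiff_subset (fun _ _ => rfl) hq)
      have h2 : P ω u = P ω' u := hPdep u fun q hq =>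
        h q (lines_subset hKJ (fun _ _ => rfl) hq)
      simp only
      rw [h1, hN ω ω' u h, h2]
    · intro ω u z hz
      rcases mem_union.1 hz with hz | hz
      · exact hR.mono _ _ _ _ _ sdiff_subset (hD ω u z hz)
      · simp only [N] at hz
        split_ifs at hz with hex
        · exact hR.trans _ _ _ _ _ (hR.mono _ _ _ _ _ hKJ hex.choose_spec.2)
            (hR.mono _ _ _ _ _ sdiff_subset (hD ω _ z hz))
        · simp at hz
    · intro ω u
      refine (card_union_le _ _).trans ?_
      have h1 := hle ω u
      have h2 : (N (P ω u) ω).card ≤ 2 ^ t := by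
        simp only [N]
        split_ifs with hex
        · exact hle _ _
        · simp
      rw [pow_succ]
      omega
    · intro u
      -- The starting points differ in a coordinate of `K`, which moves in `J \ K` preserve.
      have hdisj : ∀ ω, Disjoint (D ω u) (N (P ω u) ω) := by
        intro ω
        simp only [N]
        split_ifs with hex
        · rw [Finset.disjoint_left]
          intro z hz hz'
          have hc := hex.choose_spec
          obtain ⟨l, hl⟩ := Function.ne_iff.1 hc.1
          have hlK : l ∈ K := by
            by_contra h
            exact hl (hb ω u _ hc l h)
          have hlJ : l ∉ J \ K := by simp [hlK]
          apply hl
          rw [← hR.eq_of_notMem _ _ _ _ l (hD ω u z hz) hlJ,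
            ← hR.eq_of_notMem _ _ _ _ l (hD ω _ z hz') hlJ]
        · exact disjoint_empty_right _
      obtain ⟨S, hS, hSK⟩ : ∃ S : Set (Fin n × Profile k),
          (∀ v : Profile k, Disjoint S (lines (J \ K) v)) ∧ ∀ v : Profile k, lines K v ⊆ S :=
        ⟨{q | q.1 ∈ K}, fun v => Set.disjoint_left.2 fun q hq hq' => (mem_sdiff.1 hq'.1).2 hq,
          fun v q hq => hq.1⟩
      have hmix : ∀ ω₁ ω₂ : Responses k,
          ((D (S.piecewise ω₁ ω₂) u ∪
            N (P (S.piecewise ω₁ ω₂) u) (S.piecewise ω₁ ω₂)).card : ℝ) =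
          (D ω₂ u).card + (N (P ω₁ u) ω₂).card := by
        intro ω₁ ω₂
        rw [card_union_of_disjoint (hdisj _)]
        push_cast
        have h1 : D (S.piecewise ω₁ ω₂) u = D ω₂ u :=
          piecewise_congr_right (hS u) (hdep u) ω₁ ω₂
        have h2 : P (S.piecewise ω₁ ω₂) u = P ω₁ u := hPdep u fun q hq => by
          simp [hSK u hq]
        have h3 : N (P ω₁ u) (S.piecewise ω₁ ω₂) = N (P ω₁ u) ω₂ := by
          simp only [N]
          split_ifs with hex
          · exact piecewise_congr_right (hS _) (hdep _) ω₁ ω₂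
          · rfl
        rw [h1, h2, h3]
      rw [mean_piecewise S]
      simp only [hmix, mean_add]
      have hq2 : 0 ≤ 2 - q := by linarith
      have hNmean : ∀ ω₁, (2 - q) ^ t * (if ∃ b, P ω₁ u b then 1 else 0) ≤
          mean fun ω₂ => ((N (P ω₁ u) ω₂).card : ℝ) := by
        intro ω₁
        simp only [N]
        split_ifs with hex
        · rw [mul_one]
          exact hmean _
        · rw [mul_zero]
          exact mean_nonneg fun _ => by simp
      have hprob : 1 - q ≤ prob fun ω => ∃ b, P ω u b := by
        have := hgrow K u hK
        rw [prob_not] at this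
        simp only [P]
        linarith
      have h2 : (2 - q) ^ t * prob (fun ω => ∃ b, P ω u b) ≤
          mean fun ω₁ => mean fun ω₂ => ((N (P ω₁ u) ω₂).card : ℝ) := by
        unfold prob
        rw [← mean_const_mul]
        refine mean_mono fun ω₁ => ?_
        convert hNmean ω₁
      rw [mean_const]
      calc (2 - q) ^ (t + 1) = (2 - q) ^ t + (2 - q) ^ t * (1 - q) := by ring
        _ ≤ (2 - q) ^ t + (2 - q) ^ t * prob (fun ω => ∃ b, P ω u b) := by gcongr
        _ ≤ _ := add_le_add (hmean u) h2

/-- The size is at most 2^t while its mean is at least (2 - q)^t ≥ 2^t (1 - tq/2) by Bernoulli. If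
it falls below 2^t/2 with probability p, the mean is at most 2^t (1 - p/2), which forces p ≤ tq. -/
theorem IsExploration.exists_large
    {R : Responses k → Finset (Fin n) → Profile k → Profile k → Prop} (hR : IsExploration R)
    {q : ℝ} (hq1 : q ≤ 1) {s : ℕ}
    (hgrow : ∀ (K : Finset (Fin n)) (a : Profile k), K.card = s →
      prob (fun ω => ¬ ∃ b, b ≠ a ∧ R ω K a b) ≤ q) (t : ℕ) (J : Finset (Fin n))
    (hJ : t * s ≤ J.card) (u : Profile k) :
    prob (fun ω => ¬ ∃ D : Finset (Profile k), 2 ^ t ≤ 2 * D.card ∧ ∀ z ∈ D, R ω J u z) ≤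
      t * q := by
  classical
  obtain ⟨D, -, hD, hle, hmean⟩ := hR.exists_doubling hq1 hgrow t J hJ
  set p := prob (fun ω => ¬ 2 ^ t ≤ 2 * (D ω u).card) with hp
  have h1 : prob (fun ω => ¬ ∃ D : Finset (Profile k), 2 ^ t ≤ 2 * D.card ∧ ∀ z ∈ D, R ω J u z)
      ≤ p := prob_mono fun ω h h' => h ⟨D ω u, h', hD ω u⟩
  refine h1.trans ?_
  have h2 : (mean fun ω => ((D ω u).card : ℝ)) ≤ 2 ^ t - 2 ^ t / 2 * p := by
    have : (mean fun ω => ((D ω u).card : ℝ)) + 2 ^ t / 2 * p ≤ 2 ^ t := by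
      rw [hp]
      unfold prob
      rw [← mean_const_mul, ← mean_add]
      refine le_trans (mean_mono fun ω => ?_) (mean_const (Ω := Responses k) (2 ^ t)).le
      have := hle ω u
      have h3 : ((D ω u).card : ℝ) ≤ 2 ^ t := by exact_mod_cast this
      split_ifs with h
      · have h4 : 2 * ((D ω u).card : ℝ) ≤ 2 ^ t := by exact_mod_cast (not_le.1 h).le
        linarith
      · linarith
    linarith
  have h3 : (2 : ℝ) ^ t * (1 - t * (q / 2)) ≤ (2 - q) ^ t := by
    have := one_add_mul_le_pow (a := -(q / 2)) (by linarith) t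
    calc (2 : ℝ) ^ t * (1 - t * (q / 2)) = 2 ^ t * (1 + t * (-(q / 2))) := by ring
      _ ≤ 2 ^ t * (1 + -(q / 2)) ^ t := by gcongr
      _ = (2 - q) ^ t := by rw [← mul_pow]; ring_nf
  have h4 := h3.trans ((hmean u).trans h2)
  have h5 : (0 : ℝ) < 2 ^ t := by positivity
  by_contra hlt
  rw [not_le] at hlt
  nlinarith

/-! ### Greedy descent to a target profile. -/

/-- Reachability of `b` by best-response moves that all set a coordinate to its value at `b`. -/
inductive Descends (ω : Responses k) (b : Profile k) : Profile k → Prop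
  | refl : Descends ω b b
  | step {a : Profile k} (i : Fin n) : a i ≠ b i → reply ω i a = b i →
      Descends ω b (Function.update a i (b i)) → Descends ω b a

theorem Descends.reach {ω : Responses k} {a b : Profile k} {J : Finset (Fin n)}
    (h : Descends ω b a) (hJ : ∀ l ∉ J, a l = b l) : Reach ω J a b := by
  induction h with
  | refl => exact Relation.ReflTransGen.refl
  | @step a i hne heq _ ih =>
    have hi : i ∈ J := by
      by_contra hi
      exact hne (hJ i hi)
    refine Reach.trans (Step.reach ⟨i, hi, ?_, rfl⟩) ?_
    · rw [heq]; exact hne.symm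
    · rw [heq]
      refine ih fun l hl => ?_
      rw [Function.update_of_ne (by rintro rfl; exact hl hi), hJ l hl]

/-- A descent never undoes an agreement with `b`, so it only consults replies of still disagreeing
players, at profiles keeping all agreements of `a`. -/
theorem Descends.congr {ω ω' : Responses k} {a b : Profile k} (h : Descends ω b a)
    (hω : ∀ p : Profile k, ∀ i, p i ≠ b i → (∀ l, a l = b l → p l = b l) →
      ω (line i p) = ω' (line i p)) : Descends ω' b a := by
  induction h with
  | refl => exact Descends.refl
  | @step a i hne heq _ ih =>
    refine Descends.step i hne ?_ (ih fun p j hj hp => hω p j hj fun l hl => hp l ?_)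
    · rw [← heq]
      exact (hω a i hne fun l hl => hl).symm
    · by_cases hli : l = i
      · subst hli; simp
      · rw [Function.update_of_ne hli, hl]

theorem dependsOn_descends {J : Finset (Fin n)} {a b : Profile k} (hJ : ∀ l ∉ J, a l = b l) :
    DependsOn (fun ω : Responses k => Descends ω b a) (lines J a) := by
  have key : ∀ ω ω' : Responses k, (∀ q ∈ lines J a, ω q = ω' q) → Descends ω b a →
      Descends ω' b a := by
    intro ω ω' h hd
    refine hd.congr fun p i hi hp => h _ (line_mem_lines ?_ ?_)
    · by_contra hiJ
      exact hi (hp i (hJ i hiJ))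
    · intro l hl
      rw [hp l (hJ l hl), hJ l hl]
  exact fun ω ω' h => propext ⟨key ω ω' h, key ω' ω fun q hq => (h q hq).symm⟩

/-- With `j + 1` wrong coordinates, the chance that no wrong player's reply is its target value is
at most `(1 - 1/κ)^(j+1)`. After a correction, all further lines are fresh. -/
theorem le_prob_descends {κ : ℕ} (hκ : ∀ i, k i ≤ κ) (d : ℕ) (a b : Profile k)
    (hd : (univ.filter fun i => a i ≠ b i).card = d) :
    ∏ j ∈ range d, (1 - (1 - 1 / (κ : ℝ)) ^ (j + 1)) ≤
      prob (fun ω : Responses k => Descends ω b a) := by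
  classical
  induction d generalizing a with
  | zero =>
    have : a = b := by
      funext i
      by_contra h
      have := card_eq_zero.1 hd
      exact absurd (mem_filter.2 ⟨mem_univ i, h⟩) (by rw [this]; simp)
    subst this
    rw [prob_of_forall fun ω => Descends.refl]
    simp
  | succ d ih =>
    set K := univ.filter fun i => a i ≠ b i with hKdef
    set π := ∏ j ∈ range d, (1 - (1 - 1 / (κ : ℝ)) ^ (j + 1)) with hπ
    have hπ0 : 0 ≤ π := by
      refine prod_nonneg fun j _ => sub_nonneg.2 (pow_le_one₀ one_sub_one_div_nonneg ?_)
      have : 0 ≤ 1 / (κ : ℝ) := by positivity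
      linarith
    let S : Set (Fin n × Profile k) := (fun i => line i a) '' {i | i ∈ K}
    have hG : 1 - (1 - 1 / (κ : ℝ)) ^ (d + 1) ≤
        prob (fun ω : Responses k => ¬ ∀ i ∈ K, reply ω i a ≠ b i) := by
      rw [prob_not]
      have := prob_forall_reply_ne_le hκ K a b
      rw [hd] at this
      linarith
    rw [prod_range_succ, prob_piecewise S]
    calc π * (1 - (1 - 1 / (κ : ℝ)) ^ (d + 1)) ≤
        π * prob (fun ω : Responses k => ¬ ∀ i ∈ K, reply ω i a ≠ b i) := by gcongr
      _ ≤ _ := by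
        rw [prob, ← mean_const_mul]
        refine mean_mono fun ω₁ => ?_
        by_cases h : ∃ i ∈ K, reply ω₁ i a = b i
        · rw [if_pos (by push Not; exact h)]
          obtain ⟨i, hi, hrep⟩ := h
          have hne : a i ≠ b i := (mem_filter.1 hi).2
          rw [mul_one]
          refine (ih (Function.update a i (b i)) ?_).trans (prob_mono fun ω₂ h₂ => ?_)
          · have : (univ.filter fun j => Function.update a i (b i) j ≠ b j) = K.erase i := by
              ext j
              by_cases hj : j = i
              · subst hj; simp
              · simp [hKdef, hj]
            rw [this, card_erase_of_mem hi, hd]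
            rfl
          · refine Descends.step i hne ?_ (h₂.congr fun p j hj hp => ?_)
            · have : line i a ∈ S := ⟨i, hi, rfl⟩
              rw [← hrep]
              exact Set.piecewise_eq_of_mem _ _ _ this
            -- Later profiles have coordinate `i` equal to `b i`, unlike `a`, and player `i` moves
            -- no more; hence the frozen lines through `a` do not recur.
            · have : line j p ∉ S := by
                rintro ⟨i', -, he⟩
                have hi' : i' = j := congrArg Prod.fst he
                subst hi'
                have hpi : p i = b i := hp i (by simp)
                have hij : i ≠ i' := by rintro rfl; exact hj hpi
                exact hne ((line_eq_line.1 he i hij).trans hpi)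
              exact (Set.piecewise_eq_of_notMem _ _ _ this).symm
        · rw [if_neg (by push Not; push Not at h; exact h), mul_zero]
          exact prob_nonneg _

end BestResponse

/-! ### Amplifying explorations and joining the two sides. -/

namespace BestResponse

open Finset UniformProduct

variable {n : ℕ} {k : Fin n → ℕ} [∀ i, NeZero (k i)]

/-- The starting points differ in coordinates of `I`, outside `J`, so their explorations read
disjoint sets of lines and fail independently. -/
theorem IsExploration.prob_forall_not_exists_large_le
    {R : Responses k → Finset (Fin n) → Profile k → Profile k → Prop} (hR : IsExploration R)
    {q : ℝ} (hq1 : q ≤ 1) {s : ℕ}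
    (hgrow : ∀ (K : Finset (Fin n)) (a : Profile k), K.card = s →
      prob (fun ω => ¬ ∃ b, b ≠ a ∧ R ω K a b) ≤ q) (t : ℕ) (J : Finset (Fin n))
    (hJ : t * s ≤ J.card) (u x : Profile k) (I : Finset (Fin n)) (hIJ : Disjoint I J)
    (hx : ∀ i ∈ I, x i ≠ u i) :
    prob (fun ω => ∀ i ∈ I, ¬ ∃ D : Finset (Profile k), 2 ^ t ≤ 2 * D.card ∧
      ∀ z ∈ D, R ω J (Function.update u i (x i)) z) ≤ (t * q) ^ I.card := by
  rw [prob_forall_mem (L := fun i => lines J (Function.update u i (x i)))]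
  · rw [← prod_const]
    exact prod_le_prod (fun i _ => prob_nonneg _) fun i _ => hR.exists_large hq1 hgrow t J hJ _
  · intro i _ ω ω' h
    exact congrArg Not (hR.dependsOn_exists (2 ^ t) J (Function.update u i (x i)) h)
  · intro i hi j _ hij
    refine disjoint_lines_of_ne (l := i) (Finset.disjoint_left.1 hIJ hi) ?_
    simpa [hij] using hx i hi

/-- With many improving directions in `I`, the profile `v` reaches many profiles by moves in the
directions `I ∪ J`, with high probability. -/
theorem prob_forward_small_le (hk : ∀ i, 2 ≤ k i) {s t d : ℕ} {I J : Finset (Fin n)}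
    (hIJ : Disjoint I J) (hJ : t * s ≤ J.card) (v : Profile k) :
    prob (fun ω : Responses k => d ≤ (I.filter fun i => reply ω i v ≠ v i).card ∧
      ¬ ∃ D : Finset (Profile k), 2 ^ t ≤ 2 * D.card ∧ ∀ z ∈ D, Reach ω (I ∪ J) v z) ≤
      (t * (1 / 2) ^ s) ^ d := by
  classical
  obtain ⟨S, hSI, hSJ⟩ : ∃ S : Set (Fin n × Profile k),
      (∀ i ∈ I, ∀ u, line i u ∈ S) ∧ ∀ u, Disjoint (lines J u) S :=
    ⟨{q | q.1 ∈ I}, fun i hi _ => hi,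
      fun u => Set.disjoint_left.2 fun q hq hq' => Finset.disjoint_left.1 hIJ hq' hq.1⟩
  refine prob_le_of_forall_piecewise S fun ω₁ => ?_
  have hrep : ∀ ω₂, ∀ i ∈ I, reply (S.piecewise ω₁ ω₂) i v = reply ω₁ i v := fun ω₂ i hi =>
    Set.piecewise_eq_of_mem _ _ _ (hSI i hi v)
  have hfilter : ∀ ω₂, (I.filter fun i => reply (S.piecewise ω₁ ω₂) i v ≠ v i) =
      I.filter fun i => reply ω₁ i v ≠ v i := fun ω₂ =>
    filter_congr fun i hi => by rw [hrep ω₂ i hi]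
  simp only [hfilter]
  by_cases hd : d ≤ (I.filter fun i => reply ω₁ i v ≠ v i).card
  · obtain ⟨O, hO, hOd⟩ := exists_subset_card_eq hd
    have hOI : O ⊆ I := hO.trans (filter_subset _ _)
    rw [← hOd]
    refine le_trans (prob_mono ?_) (isExploration_reach.prob_forall_not_exists_large_le
      (q := (1 / 2) ^ s) (s := s) (pow_le_one₀ (by norm_num) (by norm_num))
      (fun K a hK => hK ▸ prob_forall_not_reach_le hk K a) t J hJ v (fun i => reply ω₁ i v) O
      (hIJ.mono_left hOI) fun i hi => (mem_filter.1 (hO hi)).2)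
    rintro ω₂ ⟨-, h⟩ i hi ⟨D, hD, hz⟩
    refine h ⟨D, hD, fun z hz' => ?_⟩
    refine Reach.trans (Step.reach ⟨i, mem_union_left _ (hOI hi), ?_, rfl⟩) ?_
    · rw [hrep ω₂ i (hOI hi)]
      exact (mem_filter.1 (hO hi)).2
    · rw [hrep ω₂ i (hOI hi)]
      refine Reach.mono subset_union_right ((hz z hz').congr fun q hq => ?_)
      exact (Set.piecewise_eq_of_notMem _ _ _ (Set.disjoint_left.1 (hSJ _) hq)).symm
  · rw [prob_of_forall_not fun ω h => hd h.1]
    positivity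

theorem prob_backward_small_le {κ : ℕ} (hk : ∀ i, 2 ≤ k i) (hκ : ∀ i, k i ≤ κ) {s t : ℕ}
    {I J : Finset (Fin n)} (hIJ : Disjoint I J) (hJ : t * s ≤ J.card) (w x : Profile k)
    (hx : ∀ i, x i ≠ w i) :
    prob (fun ω : Responses k => ¬ ∃ i ∈ I, ∃ D : Finset (Profile k), 2 ^ t ≤ 2 * D.card ∧
      ∀ z ∈ D, Reach ω J z (Function.update w i (x i))) ≤
      (t * (1 - 1 / (κ : ℝ)) ^ s) ^ I.card := by
  have h1 : 1 - 1 / (κ : ℝ) ≤ 1 := by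
    have : 0 ≤ 1 / (κ : ℝ) := by positivity
    linarith
  refine le_trans (prob_mono fun ω h => ?_)
    (isExploration_reach_swap.prob_forall_not_exists_large_le
    (q := (1 - 1 / (κ : ℝ)) ^ s) (s := s) (pow_le_one₀ one_sub_one_div_nonneg h1)
    (fun K a hK => hK ▸ prob_forall_not_reach_right_le hk hκ K a) t J hJ w x I hIJ
    fun i _ => hx i)
  exact fun i hi hD => h ⟨i, hi, hD⟩

theorem card_sub_one_le_card_filter_not {α : Type*} (F : Finset α) (p : α → Prop)
    [DecidablePred p] (h : ∀ a ∈ F, ∀ b ∈ F, p a → p b → a = b) :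
    F.card - 1 ≤ (F.filter fun a => ¬ p a).card := by
  have h1 : (F.filter p).card ≤ 1 := card_le_one.2 fun a ha b hb =>
    h a (mem_filter.1 ha).1 b (mem_filter.1 hb).1 (mem_filter.1 ha).2 (mem_filter.1 hb).2
  have h2 := card_filter_add_card_filter_not (s := F) p
  omega

theorem exists_injective_fin {α : Type*} {F : Finset α} {M : ℕ} (h : M ≤ F.card) :
    ∃ f : Fin M → α, Function.Injective f ∧ ∀ m, f m ∈ F := by
  obtain ⟨G, hGF, hG⟩ := exists_subset_card_eq h
  let e := G.equivFinOfCardEq hG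
  exact ⟨fun m => (e.symm m).1, fun a b hab => e.symm.injective (Subtype.ext hab),
    fun m => hGF (e.symm m).2⟩

/-- If many profiles are reachable from `v` by moves in the directions `J`, and some profile of `Y`
is reachable from many profiles by moves in the directions `Jᶜ`, then some profile of `Y` is
reachable from `v`, with high probability. -/
theorem prob_not_connect_le {π : ℝ} (hπ0 : 0 ≤ π)
    (hπ : ∀ a b : Profile k, π ≤ prob fun ω : Responses k => Descends ω b a)
    (J : Finset (Fin n)) (v w : Profile k) (Y : Set (Profile k))
    (hY : ∀ y ∈ Y, ∀ l ∈ J, y l = w l) (M : ℕ) :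
    prob (fun ω : Responses k =>
      (∃ F : Finset (Profile k), M < F.card ∧ ∀ z ∈ F, Reach ω J v z) ∧
      (∃ B : Finset (Profile k), M < B.card ∧ ∃ y ∈ Y, ∀ z ∈ B, Reach ω Jᶜ z y) ∧
      ¬ ∃ y ∈ Y, Reach ω univ v y) ≤ (1 - π ^ 2) ^ M := by
  classical
  obtain ⟨S, hS⟩ : ∃ S : Set (Fin n × Profile k), S = lines J v ∪ lines Jᶜ w := ⟨_, rfl⟩
  have hSv : lines J v ⊆ S := hS ▸ Set.subset_union_left
  have hSw : lines Jᶜ w ⊆ S := hS ▸ Set.subset_union_right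
  have hlines : ∀ y ∈ Y, lines Jᶜ y ⊆ lines Jᶜ w := fun y hy =>
    lines_subset subset_rfl fun l hl => hY y hy l (by simpa using hl)
  have hpow : 0 ≤ (1 - π ^ 2) ^ M := by
    have h1 := hπ v v
    have h2 := prob_le_one fun ω : Responses k => Descends ω v v
    refine pow_nonneg (sub_nonneg.2 (pow_le_one₀ hπ0 (h1.trans h2))) _
  have hmem : ∀ (ω₁ ω₂ : Responses k), ∀ q ∈ S, S.piecewise ω₁ ω₂ q = ω₁ q := fun ω₁ ω₂ q hq =>
    Set.piecewise_eq_of_mem _ _ _ hq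
  have hF : ∀ (ω ω' : Responses k), (∀ q ∈ S, ω q = ω' q) → ∀ z, Reach ω J v z →
      Reach ω' J v z := fun ω ω' h z hr => hr.congr fun q hq => h q (hSv hq)
  have hB : ∀ (ω ω' : Responses k), (∀ q ∈ S, ω q = ω' q) → ∀ y ∈ Y, ∀ z, Reach ω Jᶜ z y →
      Reach ω' Jᶜ z y := fun ω ω' h y hy z hr => hr.congr fun q hq => h q <| hSw <|
    hlines y hy (lines_subset subset_rfl (fun l hl => (hr.eq_of_notMem hl).symm) hq)
  refine prob_le_of_forall_piecewise S fun ω₁ => ?_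
  by_cases hFB : (∃ F : Finset (Profile k), M < F.card ∧ ∀ z ∈ F, Reach ω₁ J v z) ∧
      ∃ B : Finset (Profile k), M < B.card ∧ ∃ y ∈ Y, ∀ z ∈ B, Reach ω₁ Jᶜ z y
  swap
  · rw [prob_of_forall_not]
    · exact hpow
    · rintro ω₂ ⟨⟨F, hFM, hFr⟩, ⟨B, hBM, y, hy, hBr⟩, -⟩
      exact hFB ⟨⟨F, hFM, fun z hz => hF _ _ (hmem ω₁ ω₂) z (hFr z hz)⟩,
        ⟨B, hBM, y, hy, fun z hz => hB _ _ (hmem ω₁ ω₂) y hy z (hBr z hz)⟩⟩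
  obtain ⟨⟨F, hFM, hFr⟩, B, hBM, y, hy, hBr⟩ := hFB
  have hFv : ∀ z ∈ F, ∀ l ∉ J, z l = v l := fun z hz l hl => (hFr z hz).eq_of_notMem hl
  have hBw : ∀ z ∈ B, ∀ l ∈ J, z l = w l := fun z hz l hl => by
    rw [← hY y hy l hl]
    exact ((hBr z hz).eq_of_notMem (by simpa using hl)).symm
  -- At most one profile of `F` lies in the subcube already revealed around `w`. Dropping it leaves
  -- `M` profiles whose `Jᶜ`-lines are fresh; likewise for `B`. This is why both sets need more than
  -- `M` elements.
  obtain ⟨f, hf, hfF⟩ := exists_injective_fin (M := M)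
    ((Nat.le_sub_one_of_lt hFM).trans (card_sub_one_le_card_filter_not F
      (fun z => ∀ l ∈ J, z l = w l) fun a ha b hb hpa hpb => funext fun l => by
        by_cases hl : l ∈ J
        · rw [hpa l hl, hpb l hl]
        · rw [hFv a ha l hl, hFv b hb l hl]))
  obtain ⟨g, hg, hgB⟩ := exists_injective_fin (M := M)
    ((Nat.le_sub_one_of_lt hBM).trans (card_sub_one_le_card_filter_not B
      (fun z => ∀ l ∉ J, z l = v l) fun a ha b hb hpa hpb => funext fun l => by
        by_cases hl : l ∈ J
        · rw [hBw a ha l hl, hBw b hb l hl]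
        · rw [hpa l hl, hpb l hl]))
  simp only [mem_filter] at hfF hgB
  -- The hybrid: `f m` descends to it using directions in `Jᶜ`, and it descends to `g m` using
  -- directions in `J`. Distinct `m` use disjoint lines.
  let h : Fin M → Profile k := fun m => J.piecewise (f m) (g m)
  have hhf : ∀ m, ∀ l ∉ Jᶜ, f m l = h m l := fun m l hl => by
    have : l ∈ J := by simpa using hl
    simp [h, this]
  have hhg : ∀ m, ∀ l ∉ J, h m l = g m l := fun m l hl => by simp [h, hl]
  have hJc : Disjoint J Jᶜ := disjoint_compl_right
  have hfS : ∀ m, Disjoint (lines Jᶜ (f m)) S := by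
    intro m
    rw [hS]
    refine Set.disjoint_union_right.2 ⟨disjoint_lines hJc.symm _ _, ?_⟩
    have := (hfF m).2
    push Not at this
    obtain ⟨l, hl, hne⟩ := this
    exact disjoint_lines_of_ne (l := l) (by simpa using hl) hne
  have hhS : ∀ m, Disjoint (lines J (h m)) S := by
    intro m
    rw [hS]
    refine Set.disjoint_union_right.2 ⟨?_, disjoint_lines hJc _ _⟩
    have := (hgB m).2
    push Not at this
    obtain ⟨l, hl, hne⟩ := this
    exact disjoint_lines_of_ne (l := l) hl (by rwa [hhg m l hl])
  let E : Fin M → Responses k → Prop := fun m ω => Descends ω (h m) (f m) ∧ Descends ω (g m) (h m)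
  have hEdep1 := fun m => dependsOn_descends (hhf m)
  have hEdep2 := fun m => dependsOn_descends (hhg m)
  have hEdep : ∀ m, DependsOn (E m) (lines Jᶜ (f m) ∪ lines J (h m)) := by
    intro m ω ω' hω
    have e1 := hEdep1 m fun q hq => hω q (Or.inl hq)
    have e2 := hEdep2 m fun q hq => hω q (Or.inr hq)
    exact congrArg₂ And e1 e2
  have hEprob : ∀ m, π ^ 2 ≤ prob (E m) := by
    intro m
    rw [prob_and (disjoint_lines hJc.symm _ _) (hEdep1 m) (hEdep2 m), sq]
    exact mul_le_mul (hπ _ _) (hπ _ _) hπ0 (prob_nonneg _)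
  calc _ ≤ prob (fun ω₂ : Responses k => ∀ m ∈ (univ : Finset (Fin M)), ¬ E m ω₂) := by
        refine prob_mono ?_
        rintro ω₂ ⟨-, -, hnot⟩ m - ⟨hE1, hE2⟩
        have hout : ∀ {T : Set (Fin n × Profile k)}, Disjoint T S → ∀ q ∈ T,
            ω₂ q = S.piecewise ω₁ ω₂ q := fun hT q hq =>
          (Set.piecewise_eq_of_notMem _ _ _ (Set.disjoint_left.1 hT hq)).symm
        have r1 := hF ω₁ (S.piecewise ω₁ ω₂) (fun q hq => (hmem _ _ q hq).symm) _
          (hFr _ (hfF m).1)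
        have r2 := (hE1.reach (hhf m)).congr (hout (hfS m))
        have r3 := (hE2.reach (hhg m)).congr (hout (hhS m))
        have r4 := hB ω₁ (S.piecewise ω₁ ω₂) (fun q hq => (hmem _ _ q hq).symm) y hy _
          (hBr _ (hgB m).1)
        exact hnot ⟨y, hy, (r1.mono (subset_univ _)).trans ((r2.mono (subset_univ _)).trans
          ((r3.mono (subset_univ _)).trans (r4.mono (subset_univ _))))⟩
    _ = ∏ m : Fin M, prob (fun ω₂ => ¬ E m ω₂) := by
        refine prob_forall_mem (L := fun m => lines Jᶜ (f m) ∪ lines J (h m)) ?_ ?_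
        · intro m _ ω ω' hω
          exact congrArg Not (hEdep m hω)
        · intro m _ m' _ hne
          rw [Set.disjoint_union_left, Set.disjoint_union_right, Set.disjoint_union_right]
          refine ⟨⟨?_, disjoint_lines hJc.symm _ _⟩, disjoint_lines hJc _ _, ?_⟩
          · obtain ⟨l, hl⟩ := Function.ne_iff.1 (hf.ne hne)
            refine disjoint_lines_of_ne (l := l) ?_ hl
            intro hlJ
            rw [mem_compl] at hlJ
            exact hl ((hFv _ (hfF m).1 l hlJ).trans (hFv _ (hfF m').1 l hlJ).symm)
          · obtain ⟨l, hl⟩ := Function.ne_iff.1 (hg.ne hne)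
            have hlJ : l ∉ J := fun hlJ =>
              hl ((hBw _ (hgB m).1 l hlJ).trans (hBw _ (hgB m').1 l hlJ).symm)
            exact disjoint_lines_of_ne hlJ (by rwa [hhg m l hlJ, hhg m' l hlJ])
    _ ≤ ∏ _m : Fin M, (1 - π ^ 2) := by
        refine prod_le_prod (fun m _ => prob_nonneg _) fun m _ => ?_
        rw [prob_not]
        linarith [hEprob m]
    _ = _ := by simp

/-! ### Rarity of adjacent profiles with few improving players. -/

/-- The number of players whose action at `v` is not a best response. -/
noncomputable def outDegree (ω : Responses k) (v : Profile k) : ℕ :=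
  (univ.filter fun i => reply ω i v ≠ v i).card

theorem prod_inv_compl_le {κ : ℕ} (hκ : ∀ i, k i ≤ κ) (T : Finset (Fin n)) :
    ∏ i ∈ Tᶜ, (1 / (k i : ℝ)) ≤ κ ^ T.card / ∏ i, (k i : ℝ) := by
  have hpos : ∀ i, (0 : ℝ) < k i := fun i => by exact_mod_cast Nat.pos_of_neZero (k i)
  have h1 : ∏ i ∈ T, (k i : ℝ) ≤ κ ^ T.card := by
    rw [← prod_const]
    exact prod_le_prod (fun i _ => (hpos i).le) fun i _ => by exact_mod_cast hκ i
  rw [← prod_mul_prod_compl T fun i => (k i : ℝ)]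
  have h2 : 0 < ∏ i ∈ T, (k i : ℝ) := prod_pos fun i _ => hpos i
  have h3 : 0 < ∏ i ∈ Tᶜ, (k i : ℝ) := prod_pos fun i _ => hpos i
  rw [prod_div_distrib, prod_const_one]
  rw [div_le_div_iff₀ h3 (by positivity)]
  nlinarith

/-- The two profiles share only the line of player `j`. Ignoring that player makes the events
independent, at the cost of one factor κ each. The resulting N^(-2) leaves room for a union bound
over N profiles, which a single low-degree profile would not. -/
theorem prob_adjacent_outDegree_le {κ d : ℕ} (hd : d ≤ n) (hκ : ∀ i, k i ≤ κ) (v : Profile k)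
    (j : Fin n) (x : Fin (k j)) (hx : x ≠ v j) :
    prob (fun ω : Responses k => outDegree ω v ≤ d ∧
      outDegree ω (Function.update v j x) ≤ d) ≤
      (n ^ d * (κ ^ (d + 1) / ∏ i, (k i : ℝ))) ^ 2 := by
  classical
  have hκ1 : (1 : ℝ) ≤ κ := by
    exact_mod_cast (NeZero.one_le (n := k j)).trans (hκ j)
  set v' := Function.update v j x with hv'
  let G : Profile k → Finset (Fin n) → Responses k → Prop := fun u T ω =>
    ∀ i ∈ (insert j T)ᶜ, reply ω i u = u i
  let 𝒯 : Finset (Finset (Fin n)) := powersetCard d univ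
  have hcover : ∀ ω u, outDegree ω u ≤ d → ∃ T ∈ 𝒯, G u T ω := by
    intro ω u h
    obtain ⟨T, hT, hTd⟩ := exists_superset_card_eq (n := d) h (by simpa using hd)
    refine ⟨T, by simp [𝒯, mem_powersetCard, hTd], fun i hi => ?_⟩
    by_contra hne
    have : i ∈ T := hT (mem_filter.2 ⟨mem_univ i, hne⟩)
    simp [this] at hi
  let c : ℝ := κ ^ (d + 1) / ∏ i, (k i : ℝ)
  have hc : 0 ≤ c := by positivity
  have hG : ∀ u, ∀ T ∈ 𝒯, prob (G u T) ≤ c := by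
    intro u T hT
    rw [prob_forall_reply_eq]
    refine (prod_inv_compl_le hκ _).trans ?_
    have h1 : (insert j T).card ≤ d + 1 := by
      have := card_insert_le j T
      have h2 := (mem_powersetCard.1 hT).2
      omega
    have := pow_le_pow_right₀ hκ1 h1
    exact div_le_div_of_nonneg_right this (by positivity)
  have hdep : ∀ u T, DependsOn (G u T) {q | ∃ i, i ≠ j ∧ q = line i u} := by
    intro u T ω ω' h
    refine propext (forall₂_congr fun i hi => ?_)
    have hij : i ≠ j := by rintro rfl; simp at hi
    have : reply ω i u = reply ω' i u := h (line i u) ⟨i, hij, rfl⟩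
    rw [this]
  have hdisj : Disjoint {q | ∃ i, i ≠ j ∧ q = line i v} {q | ∃ i, i ≠ j ∧ q = line i v'} := by
    rw [Set.disjoint_left]
    rintro q ⟨i, hi, rfl⟩ ⟨i', -, he⟩
    have hii' : i = i' := congrArg Prod.fst he
    subst hii'
    have := line_eq_line.1 he j hi.symm
    simp [hv'] at this
    exact hx this.symm
  calc _ ≤ prob (fun ω : Responses k => ∃ p ∈ 𝒯 ×ˢ 𝒯, G v p.1 ω ∧ G v' p.2 ω) := by
        refine prob_mono fun ω h => ?_
        obtain ⟨T, hT, h1⟩ := hcover ω v h.1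
        obtain ⟨T', hT', h2⟩ := hcover ω v' h.2
        exact ⟨(T, T'), mem_product.2 ⟨hT, hT'⟩, h1, h2⟩
    _ ≤ ∑ p ∈ 𝒯 ×ˢ 𝒯, prob (fun ω : Responses k => G v p.1 ω ∧ G v' p.2 ω) :=
        prob_exists_le _ _
    _ ≤ ∑ p ∈ 𝒯 ×ˢ 𝒯, c * c := by
        refine sum_le_sum fun p hp => ?_
        rw [prob_and hdisj (hdep _ _) (hdep _ _)]
        have := mem_product.1 hp
        exact mul_le_mul (hG _ _ this.1) (hG _ _ this.2) (prob_nonneg _) hc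
    _ = (n.choose d * c) ^ 2 := by
        rw [sum_const, card_product]
        simp only [𝒯, card_powersetCard, card_univ, Fintype.card_fin]
        ring
    _ ≤ (n ^ d * c) ^ 2 := by
        have : (n.choose d : ℝ) ≤ n ^ d := by exact_mod_cast Nat.choose_le_pow n d
        gcongr

theorem prob_exists_adjacent_outDegree_le {κ d : ℕ} (hd : d ≤ n) (hκ : ∀ i, k i ≤ κ) :
    prob (fun ω : Responses k => ∃ v : Profile k, ∃ j, ∃ x, x ≠ v j ∧ outDegree ω v ≤ d ∧
      outDegree ω (Function.update v j x) ≤ d) ≤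
      n ^ (2 * d + 1) * κ ^ (2 * d + 3) / ∏ i, (k i : ℝ) := by
  classical
  have hcard : (Fintype.card (Profile k) : ℝ) = ∏ i, (k i : ℝ) := by simp
  have hpos : (0 : ℝ) < ∏ i, (k i : ℝ) := by
    rw [← hcard]; exact_mod_cast Fintype.card_pos
  let c : ℝ := (n ^ d * (κ ^ (d + 1) / ∏ i, (k i : ℝ))) ^ 2
  have hc : 0 ≤ c := by positivity
  calc _ ≤ prob (fun ω : Responses k => ∃ p ∈ (univ : Finset (Profile k × (Σ j, Fin (k j)))),
          p.2.2 ≠ p.1 p.2.1 ∧ outDegree ω p.1 ≤ d ∧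
            outDegree ω (Function.update p.1 p.2.1 p.2.2) ≤ d) := by
        refine prob_mono ?_
        rintro ω ⟨v, j, x, h⟩
        exact ⟨(v, ⟨j, x⟩), mem_univ _, h⟩
    _ ≤ ∑ p : Profile k × (Σ j, Fin (k j)), c := by
        refine (prob_exists_le _ _).trans (sum_le_sum fun p _ => ?_)
        by_cases hp : p.2.2 = p.1 p.2.1
        · rw [prob_of_forall_not fun ω h => h.1 hp]
          exact hc
        · exact (prob_mono fun ω h => h.2).trans (prob_adjacent_outDegree_le hd hκ _ _ _ hp)
    _ = (∏ i, (k i : ℝ)) * (∑ j, (k j : ℝ)) * c := by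
        rw [sum_const, card_univ, Fintype.card_prod, Fintype.card_sigma, nsmul_eq_mul]
        push_cast
        rw [hcard]
        simp
    _ ≤ (∏ i, (k i : ℝ)) * (n * κ) * c := by
        have : ∑ j, (k j : ℝ) ≤ n * κ := by
          calc ∑ j, (k j : ℝ) ≤ ∑ _j : Fin n, (κ : ℝ) :=
                sum_le_sum fun j _ => by exact_mod_cast hκ j
            _ = _ := by simp
        gcongr
    _ = _ := by
        simp only [c]
        field_simp
        ring

end BestResponse

/-! ### Descent constant and reaching the neighbourhood of a fixed profile. -/

namespace BestResponse

open Finset UniformProduct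

/-- The first κ factors are at least (j+1)/(2κ), with product at least κ!/(2κ)^κ ≥ 6^(-κ). The m-th
later block of κ factors contributes at least (1 - (2/5)^m)^κ, since 1/e < 2/5, and the blocks
together at least 3^(-κ). -/
theorem inv_pow_le_prod_one_sub_pow {κ : ℕ} (hκ : 1 ≤ κ) (d : ℕ) :
    (1 / 18 : ℝ) ^ κ ≤ ∏ j ∈ range d, (1 - (1 - 1 / (κ : ℝ)) ^ (j + 1)) := by
  have hκ0 : (1 : ℝ) ≤ κ := by exact_mod_cast hκ
  set x : ℝ := 1 - 1 / (κ : ℝ) with hx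
  have hx0 : 0 ≤ x := one_sub_one_div_nonneg
  have hx1 : x ≤ 1 := by
    have : 0 ≤ 1 / (κ : ℝ) := by positivity
    linarith
  have hexp : ∀ j : ℕ, x ^ j ≤ Real.exp (-(j / κ)) := by
    intro j
    have h1 : x ≤ Real.exp (-(1 / κ)) := by
      have := Real.add_one_le_exp (-(1 / (κ : ℝ)))
      linarith
    calc x ^ j ≤ Real.exp (-(1 / κ)) ^ j := by gcongr
      _ = _ := by rw [← Real.exp_nat_mul]; congr 1; ring
  have hfac : ∀ j, 0 ≤ 1 - x ^ (j + 1) := fun j => sub_nonneg.2 (pow_le_one₀ hx0 hx1)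
  have hxκ : x ^ κ ≤ 2 / 5 := by
    refine (hexp κ).trans ?_
    rw [div_self (by positivity), Real.exp_neg]
    have := Real.exp_one_gt_d9
    rw [inv_le_comm₀ (by positivity) (by norm_num)]
    linarith
  have hfirst : (1 / 6 : ℝ) ^ κ ≤ ∏ j ∈ range κ, (1 - x ^ (j + 1)) := by
    have h1 : ∏ j ∈ range κ, (((j + 1 : ℕ) : ℝ) / (2 * κ)) ≤ ∏ j ∈ range κ, (1 - x ^ (j + 1)) := by
      refine prod_le_prod (fun j _ => by positivity) fun j hj => ?_
      have hj' : ((j + 1 : ℕ) : ℝ) ≤ κ := by exact_mod_cast mem_range.1 hj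
      set u : ℝ := ((j + 1 : ℕ) : ℝ) / κ with hu
      have hu0 : 0 ≤ u := by positivity
      have hu1 : u ≤ 1 := div_le_one_of_le₀ hj' (by positivity)
      have h2 : x ^ (j + 1) ≤ 1 / (1 + u) := by
        refine (hexp (j + 1)).trans ?_
        rw [Real.exp_neg, one_div]
        gcongr
        linarith [Real.add_one_le_exp u]
      have h3 : 1 / (1 + u) ≤ 1 - u / 2 := by
        rw [div_le_iff₀ (by positivity)]
        nlinarith
      have h4 : ((j + 1 : ℕ) : ℝ) / (2 * κ) = u / 2 := by rw [hu]; field_simp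
      rw [h4]
      linarith
    refine le_trans ?_ h1
    rw [prod_div_distrib, ← Nat.cast_prod, prod_range_add_one_eq_factorial, prod_const, card_range]
    have h2 : (κ : ℝ) ^ κ / κ.factorial ≤ 3 ^ κ := by
      refine (Real.pow_div_factorial_le_exp (κ : ℝ) (by positivity) κ).trans ?_
      rw [← mul_one (κ : ℝ), Real.exp_nat_mul]
      have := Real.exp_one_lt_d9
      gcongr
      linarith
    have hf : (0 : ℝ) < κ.factorial := by exact_mod_cast Nat.factorial_pos κ
    rw [div_le_iff₀ hf] at h2
    rw [le_div_iff₀ (by positivity), div_pow, one_pow, mul_pow]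
    have h3 : (6 : ℝ) ^ κ = 2 ^ κ * 3 ^ κ := by rw [← mul_pow]; norm_num
    rw [h3, one_div_mul_eq_div, div_le_iff₀ (by positivity)]
    have : (0 : ℝ) < 2 ^ κ := by positivity
    nlinarith
  -- The bound 1/3 is strengthened to a decreasing sequence that starts at 1, so that the induction
  -- closes.
  have hgroup : ∀ m : ℕ, (1 / 6 : ℝ) ^ κ * ((1 + 2 * (2 / 5) ^ m) / 3) ^ κ ≤
      ∏ j ∈ range (κ * (m + 1)), (1 - x ^ (j + 1)) := by
    intro m
    induction m with
    | zero => norm_num; simpa using hfirst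
    | succ m ih =>
      rw [show κ * (m + 1 + 1) = κ * (m + 1) + κ by ring, prod_range_add]
      have h1 : (1 - (2 / 5 : ℝ) ^ (m + 1)) ^ κ ≤
          ∏ j ∈ range κ, (1 - x ^ (κ * (m + 1) + j + 1)) := by
        rw [← card_range κ, ← prod_const, card_range]
        refine prod_le_prod (fun j _ => sub_nonneg.2 (pow_le_one₀ (by norm_num) (by norm_num)))
          fun j _ => ?_
        have : x ^ (κ * (m + 1) + j + 1) ≤ (2 / 5) ^ (m + 1) := by
          calc x ^ (κ * (m + 1) + j + 1) ≤ x ^ (κ * (m + 1)) :=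
                pow_le_pow_of_le_one hx0 hx1 (by omega)
            _ = (x ^ κ) ^ (m + 1) := by rw [pow_mul]
            _ ≤ _ := by gcongr
        linarith
      have h0 : (0 : ℝ) ≤ (1 - (2 / 5 : ℝ) ^ (m + 1)) ^ κ :=
        pow_nonneg (sub_nonneg.2 (pow_le_one₀ (by norm_num) (by norm_num))) _
      refine le_trans ?_ (mul_le_mul ih h1 h0 (prod_nonneg fun j _ => hfac j))
      rw [mul_assoc]
      refine mul_le_mul_of_nonneg_left ?_ (by positivity)
      rw [← mul_pow]
      have h2 : (2 / 5 : ℝ) ^ m ≤ 1 := pow_le_one₀ (by norm_num) (by norm_num)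
      have h3 : (0 : ℝ) ≤ (2 / 5 : ℝ) ^ m := by positivity
      refine pow_le_pow_left₀ (by positivity) ?_ κ
      rw [pow_succ]
      nlinarith
  have hanti : ∏ j ∈ range (κ * (d + 1)), (1 - x ^ (j + 1)) ≤
      ∏ j ∈ range d, (1 - x ^ (j + 1)) := by
    refine prod_le_prod_of_subset_of_le_one (range_mono (by nlinarith)) (fun j _ => hfac j)
      fun j _ _ => ?_
    have : 0 ≤ x ^ (j + 1) := by positivity
    linarith
  refine le_trans ?_ ((hgroup d).trans hanti)
  rw [← mul_pow]
  have : (0 : ℝ) ≤ (2 / 5 : ℝ) ^ d := by positivity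
  gcongr
  linarith

variable {n : ℕ} {k : Fin n → ℕ} [∀ i, NeZero (k i)]

theorem inv_pow_le_prob_descends {κ : ℕ} (hκ1 : 1 ≤ κ) (hκ : ∀ i, k i ≤ κ) (a b : Profile k) :
    (1 / 18 : ℝ) ^ κ ≤ prob fun ω : Responses k => Descends ω b a :=
  (inv_pow_le_prod_one_sub_pow hκ1 _).trans (le_prob_descends hκ _ a b rfl)

/-- The profiles `u` and `w` lie on a common line. -/
def Near (w u : Profile k) : Prop := ∃ i, ∀ j, j ≠ i → u j = w j

omit [∀ i, NeZero (k i)] in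
theorem near_update (w : Profile k) (i : Fin n) (x : Fin (k i)) :
    Near w (Function.update w i x) := ⟨i, fun j hj => by simp [hj]⟩

/-- The three terms are adjacent low-degree profiles, failed backward searches (one per class), and
failed forward searches or connections. Only the last pays the number of profiles, since `w` is
fixed while `v` varies. -/
theorem prob_exists_not_reach_near_le {κ : ℕ} (hk : ∀ i, 2 ≤ k i) (hκ1 : 1 ≤ κ)
    (hκ : ∀ i, k i ≤ κ) (w : Profile k) {m t s d M : ℕ} (c : Fin n → Fin 4)
    (hc : ∀ r, m ≤ (univ.filter fun i => c i = r).card) (hts : t * s ≤ m) (hd : 4 * d ≤ n)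
    (hM : 2 * (M + 1) ≤ 2 ^ t) (hq : t * (1 - 1 / (κ : ℝ)) ^ s ≤ 1 / 2) :
    prob (fun ω : Responses k => ∃ v, (∃ i, reply ω i v ≠ v i) ∧
      ¬ ∃ y, Near w y ∧ Reach ω univ v y) ≤
      n ^ (8 * d + 1) * κ ^ (8 * d + 3) / ∏ i, (k i : ℝ) + 4 * (1 / 2) ^ m +
        4 * (∏ i, (k i : ℝ)) * ((t * (1 / 2) ^ s) ^ d + (1 - ((1 / 18) ^ κ) ^ 2) ^ M) := by
  classical
  have hnontriv : ∀ i, ∃ x, x ≠ w i := fun i => by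
    have : Nontrivial (Fin (k i)) := Fin.nontrivial_iff_two_le.2 (hk i)
    exact exists_ne _
  choose x hx using hnontriv
  let b : Fin 4 → Finset (Fin n) := fun r => univ.filter fun i => c i = r
  have hb : ∀ r r', r ≠ r' → Disjoint (b r) (b r') := by
    intro r r' h
    rw [Finset.disjoint_left]
    intro i hi hi'
    exact h ((mem_filter.1 hi).2.symm.trans (mem_filter.1 hi').2)
  -- From a `v` with many improving players in class `r`: first moves in `r`, forward search in `r +
  -- 1`, backward starting points in `r + 2`, backward search in `r + 3`.
  let J : Fin 4 → Finset (Fin n) := fun r => b r ∪ b (r + 1)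
  have hne : ∀ r : Fin 4, r ≠ r + 1 := by decide
  have hJ2 : ∀ r, Disjoint (J r) (b (r + 2)) := fun r => by
    rw [disjoint_union_left]
    exact ⟨hb _ _ (by revert r; decide), hb _ _ (by revert r; decide)⟩
  have hJ3 : ∀ r, b (r + 3) ⊆ (J r)ᶜ := fun r => by
    rw [subset_compl_comm, subset_compl_iff_disjoint_right, disjoint_union_left]
    exact ⟨hb _ _ (by revert r; decide), hb _ _ (by revert r; decide)⟩
  let Y : Fin 4 → Set (Profile k) := fun r => {y | ∃ i ∈ b (r + 2), y = Function.update w i (x i)}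
  have hY : ∀ r, ∀ y ∈ Y r, ∀ l ∈ J r, y l = w l := by
    rintro r _ ⟨i, hi, rfl⟩ l hl
    refine Function.update_of_ne ?_ _ _
    rintro rfl
    exact Finset.disjoint_left.1 (hJ2 r) hl hi
  let A : Responses k → Prop := fun ω => ∃ v : Profile k, ∃ j, ∃ x, x ≠ v j ∧
    outDegree ω v ≤ 4 * d ∧ outDegree ω (Function.update v j x) ≤ 4 * d
  let B : Fin 4 → Responses k → Prop := fun r ω => ∃ i ∈ b (r + 2), ∃ D : Finset (Profile k),
    2 ^ t ≤ 2 * D.card ∧ ∀ z ∈ D, Reach ω (b (r + 3)) z (Function.update w i (x i))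
  let F : Profile k → Fin 4 → Responses k → Prop := fun v r ω => ∃ D : Finset (Profile k),
    2 ^ t ≤ 2 * D.card ∧ ∀ z ∈ D, Reach ω (J r) v z
  let C₁ : Profile k × Fin 4 → Responses k → Prop := fun p ω =>
    d ≤ ((b p.2).filter fun i => reply ω i p.1 ≠ p.1 i).card ∧ ¬ F p.1 p.2 ω
  let C₂ : Profile k × Fin 4 → Responses k → Prop := fun p ω =>
    (∃ F : Finset (Profile k), M < F.card ∧ ∀ z ∈ F, Reach ω (J p.2) p.1 z) ∧
      (∃ B : Finset (Profile k), M < B.card ∧ ∃ y ∈ Y p.2, ∀ z ∈ B, Reach ω (J p.2)ᶜ z y) ∧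
      ¬ ∃ y ∈ Y p.2, Reach ω univ p.1 y
  have hhigh : ∀ ω, (∀ r, B r ω) → (∀ p, ¬ C₁ p ω) → (∀ p, ¬ C₂ p ω) → ∀ v, 4 * d < outDegree ω v →
      ∃ y, Near w y ∧ Reach ω univ v y := by
    intro ω hB hC₁ hC₂ v hv
    obtain ⟨r, hr⟩ : ∃ r, d ≤ ((b r).filter fun i => reply ω i v ≠ v i).card := by
      by_contra! hlt
      have h1 : outDegree ω v = ∑ r, ((b r).filter fun i => reply ω i v ≠ v i).card := by
        unfold outDegree
        rw [card_eq_sum_card_fiberwise (f := c) (t := univ) (fun _ _ => by simp)]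
        refine sum_congr rfl fun r _ => ?_
        congr 1
        ext i
        simp [b, and_comm]
      have h2 : ∑ r, ((b r).filter fun i => reply ω i v ≠ v i).card ≤ ∑ _r : Fin 4, d :=
        sum_le_sum fun r _ => (hlt r).le
      rw [sum_const, card_univ, Fintype.card_fin, smul_eq_mul] at h2
      omega
    have hF : F v r ω := by
      by_contra h
      exact hC₁ (v, r) ⟨hr, h⟩
    obtain ⟨D, hD, hDr⟩ := hF
    obtain ⟨i, hi, D', hD', hDr'⟩ := hB r
    by_contra hnot
    refine hC₂ (v, r) ⟨⟨D, by omega, hDr⟩, ⟨D', by omega, _, ⟨i, hi, rfl⟩,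
      fun z hz => (hDr' z hz).mono (hJ3 r)⟩, ?_⟩
    rintro ⟨y, ⟨i, -, rfl⟩, hy⟩
    exact hnot ⟨_, near_update w i (x i), hy⟩
  have hsub : ∀ ω : Responses k, (∃ v, (∃ i, reply ω i v ≠ v i) ∧
      ¬ ∃ y, Near w y ∧ Reach ω univ v y) →
      (A ω ∨ ∃ r ∈ univ, ¬ B r ω) ∨ ∃ p ∈ univ, C₁ p ω ∨ C₂ p ω := by
    rintro ω ⟨v, ⟨i, hi⟩, hv⟩
    by_contra! hnot
    obtain ⟨⟨hA, hB⟩, hC⟩ := hnot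
    have hh := hhigh ω (fun r => hB r (mem_univ _)) (fun p => (hC p (mem_univ _)).1)
      (fun p => (hC p (mem_univ _)).2)
    -- A non-sink of low out-degree has an improving move, and by the failure of `A` that move leads
    -- to high out-degree.
    by_cases hlow : outDegree ω v ≤ 4 * d
    · refine hv ?_
      obtain ⟨y, hy, hr⟩ := hh (Function.update v i (reply ω i v))
        (by by_contra! h; exact hA ⟨v, i, _, hi, hlow, h⟩)
      exact ⟨y, hy, Reach.trans (Step.reach ⟨i, mem_univ _, hi, rfl⟩) hr⟩
    · exact hv (hh v (not_le.1 hlow))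
  have hA : prob A ≤ n ^ (8 * d + 1) * κ ^ (8 * d + 3) / ∏ i, (k i : ℝ) := by
    have := prob_exists_adjacent_outDegree_le (k := k) hd hκ
    rwa [show 2 * (4 * d) = 8 * d by ring] at this
  have hB : ∀ r, prob (fun ω => ¬ B r ω) ≤ (1 / 2) ^ m := by
    intro r
    refine (prob_backward_small_le hk hκ (hb _ _ (by revert r; decide))
      (hts.trans (hc (r + 3))) w x hx).trans ?_
    have h0 : 0 ≤ t * (1 - 1 / (κ : ℝ)) ^ s :=
      mul_nonneg (Nat.cast_nonneg _) (pow_nonneg one_sub_one_div_nonneg _)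
    calc _ ≤ (1 / 2 : ℝ) ^ (b (r + 2)).card := by gcongr
      _ ≤ _ := pow_le_pow_of_le_one (by norm_num) (by norm_num) (hc _)
  have hC : ∀ p, prob (fun ω => C₁ p ω ∨ C₂ p ω) ≤
      (t * (1 / 2) ^ s) ^ d + (1 - ((1 / 18) ^ κ) ^ 2) ^ M := by
    rintro ⟨v, r⟩
    refine (prob_or_le _ _).trans (add_le_add ?_ ?_)
    · exact prob_forward_small_le hk (hb r (r + 1) (hne r))
        (hts.trans (hc (r + 1))) v
    · exact prob_not_connect_le (by positivity) (inv_pow_le_prob_descends hκ1 hκ) (J r) v w (Y r)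
        (hY r) M
  refine (prob_mono hsub).trans ((prob_or_le _ _).trans (add_le_add ((prob_or_le _ _).trans
    (add_le_add hA ((prob_exists_le _ _).trans ((sum_le_sum fun r _ => hB r).trans ?_))))
    ((prob_exists_le _ _).trans ((sum_le_sum fun p _ => hC p).trans ?_))))
  · simp
  · rw [sum_const, card_univ, Fintype.card_prod, nsmul_eq_mul]
    simp only [Fintype.card_fin, Fintype.card_pi]
    push_cast
    exact le_of_eq (by ring)

/-! ### Conditioning on a sink, and existence of sinks. -/

/-- The profile `w` is a fixed point of the best-response dynamics. -/
def Sink (ω : Responses k) (w : Profile k) : Prop := ∀ i, reply ω i w = w i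

theorem prob_sink (w : Profile k) :
    prob (fun ω : Responses k => Sink ω w) = 1 / ∏ i, (k i : ℝ) := by
  have := prob_forall_reply_eq univ w w
  rw [prod_div_distrib, prod_const_one] at this
  rw [← this]
  exact prob_congr fun ω => by simp [Sink]

theorem Sink.reach_of_near {ω : Responses k} {w u : Profile k} (hw : Sink ω w) (hu : Near w u) :
    Reach ω univ u w := by
  obtain ⟨i, hi⟩ := hu
  have hrep : reply ω i u = w i := by
    have h : Function.update u i 0 = Function.update w i 0 :=
      congrArg Prod.snd (line_eq_line.2 hi)
    let f : Profile k → Fin (k i) := fun b => ω (i, b)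
    exact (congrArg f h).trans (hw i)
  have hupd : w = Function.update u i (w i) := by
    funext j
    by_cases hj : j = i
    · subst hj; simp
    · simp [hj, hi j hj]
  by_cases h : u i = w i
  · have : u = w := by rw [hupd, ← h]; simp
    rw [this]
    exact Relation.ReflTransGen.refl
  · exact Step.reach ⟨i, mem_univ _, by rw [hrep]; exact Ne.symm h, by rw [hrep]; exact hupd⟩

/-- Freeze the replies on lines through `w`. A path from a bad `v` cannot touch those lines, as any
profile on one reaches the sink, so it is the same path under fully resampled replies, where the
bound `c` applies. -/
theorem prob_sink_and_not_reach_le {c : ℝ} (w : Profile k)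
    (hc : prob (fun ω : Responses k => ∃ v, (∃ i, reply ω i v ≠ v i) ∧
      ¬ ∃ y, Near w y ∧ Reach ω univ v y) ≤ c) :
    prob (fun ω : Responses k => Sink ω w ∧ ∃ v, ¬ Sink ω v ∧ ¬ Reach ω univ v w) ≤
      c * (1 / ∏ i, (k i : ℝ)) := by
  classical
  obtain ⟨S, hS⟩ : ∃ S : Set (Fin n × Profile k), S = {q | ∃ i, q = line i w} := ⟨_, rfl⟩
  have hin : ∀ ω₁ ω₂ i, reply (S.piecewise ω₁ ω₂) i w = reply ω₁ i w := fun ω₁ ω₂ i =>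
    Set.piecewise_eq_of_mem _ _ _ (by rw [hS]; exact ⟨i, rfl⟩)
  have hout : ∀ ω₁ ω₂ i u, ¬ Near w u → reply (S.piecewise ω₁ ω₂) i u = reply ω₂ i u := by
    intro ω₁ ω₂ i u hu
    refine Set.piecewise_eq_of_notMem _ _ _ ?_
    rw [hS]
    rintro ⟨i', he⟩
    have : i = i' := congrArg Prod.fst he
    subst this
    exact hu ⟨i, line_eq_line.1 he⟩
  rw [prob_piecewise S, ← prob_sink w, prob, ← mean_const_mul]
  refine mean_mono fun ω₁ => ?_
  by_cases hw : Sink ω₁ w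
  · rw [if_pos hw, mul_one]
    refine le_trans (prob_mono ?_) hc
    rintro ω₂ ⟨hsink, v, hv, hr⟩
    have hvw : ¬ Near w v := fun h => hr (hsink.reach_of_near h)
    refine ⟨v, ?_, ?_⟩
    · unfold Sink at hv
      push Not at hv
      obtain ⟨i, hi⟩ := hv
      exact ⟨i, by rwa [hout _ _ _ _ hvw] at hi⟩
    · rintro ⟨y, hy, hry⟩
      have key : ∀ u, Reach ω₂ univ v u → Reach (S.piecewise ω₁ ω₂) univ v u := by
        intro u hu
        induction hu with
        | refl => exact Relation.ReflTransGen.refl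
        | @tail u u' _ hstep ih =>
          have hu : ¬ Near w u := fun h => hr (ih.trans (hsink.reach_of_near h))
          obtain ⟨i, hi, hne, rfl⟩ := hstep
          refine Reach.trans ih (Step.reach ⟨i, hi, ?_, ?_⟩)
          · rwa [hout _ _ _ _ hu]
          · rw [hout _ _ _ _ hu]
      exact hr ((key y hry).trans (hsink.reach_of_near hy))
  · rw [if_neg hw, mul_zero, prob_of_forall_not]
    rintro ω₂ ⟨h, -⟩
    exact hw fun i => by rw [← hin ω₁ ω₂ i]; exact h i

theorem prob_exists_sink_not_reach_le {c : ℝ}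
    (hc : ∀ w, prob (fun ω : Responses k => ∃ v, (∃ i, reply ω i v ≠ v i) ∧
      ¬ ∃ y, Near w y ∧ Reach ω univ v y) ≤ c) :
    prob (fun ω : Responses k => ∃ w, Sink ω w ∧ ∃ v, ¬ Sink ω v ∧ ¬ Reach ω univ v w) ≤ c := by
  have hcard : (Fintype.card (Profile k) : ℝ) = ∏ i, (k i : ℝ) := by simp
  have hpos : (0 : ℝ) < ∏ i, (k i : ℝ) := by
    rw [← hcard]; exact_mod_cast Fintype.card_pos
  calc _ ≤ prob (fun ω : Responses k => ∃ w ∈ (univ : Finset (Profile k)),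
          Sink ω w ∧ ∃ v, ¬ Sink ω v ∧ ¬ Reach ω univ v w) :=
        prob_mono fun ω ⟨w, h⟩ => ⟨w, mem_univ _, h⟩
    _ ≤ ∑ _w : Profile k, c * (1 / ∏ i, (k i : ℝ)) :=
        (prob_exists_le _ _).trans (sum_le_sum fun w _ => prob_sink_and_not_reach_le w (hc w))
    _ = c := by
        rw [sum_const, card_univ, nsmul_eq_mul, hcard]
        field_simp

theorem prob_sink_and_sink_le {a b : Profile k} (hab : a ≠ b) :
    prob (fun ω : Responses k => Sink ω a ∧ Sink ω b) ≤ (1 / ∏ i, (k i : ℝ)) ^ 2 := by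
  by_cases h : ∃ i, line i a = line i b
  · obtain ⟨i, hi⟩ := h
    rw [prob_of_forall_not]
    · positivity
    · rintro ω ⟨ha, hb⟩
      refine hab (funext fun j => ?_)
      by_cases hj : j = i
      · subst hj
        let f : Profile k → Fin (k j) := fun b => ω (j, b)
        rw [← ha j, ← hb j]
        exact congrArg f (congrArg Prod.snd hi)
      · exact line_eq_line.1 hi j hj
  · have hdep : ∀ a : Profile k, DependsOn (fun ω : Responses k => Sink ω a)
        {q | ∃ i, q = line i a} := by
      intro a ω ω' hω
      refine propext (forall_congr' fun i => ?_)
      have : reply ω i a = reply ω' i a := hω (line i a) ⟨i, rfl⟩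
      rw [this]
    rw [prob_and _ (hdep a) (hdep b), prob_sink, prob_sink, sq]
    rw [Set.disjoint_left]
    rintro q ⟨i, rfl⟩ ⟨i', he⟩
    have : i = i' := congrArg Prod.fst he
    subst this
    exact h ⟨i, he⟩

/-- The number X of sinks has mean 1. Distinct profiles on a common line are never both sinks and
others are independent, so the mean of X² is at most 2. For integers (X-1)(X-2) ≥ 0, hence the
indicator of X > 0 is at least (3X - X²)/2, with mean at least 1/2. -/
theorem half_le_prob_exists_sink :
    1 / 2 ≤ prob (fun ω : Responses k => ∃ w, Sink ω w) := by
  classical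
  have hcard : (Fintype.card (Profile k) : ℝ) = ∏ i, (k i : ℝ) := by simp
  have hpos : (0 : ℝ) < ∏ i, (k i : ℝ) := by
    rw [← hcard]; exact_mod_cast Fintype.card_pos
  set N : ℝ := ∏ i, (k i : ℝ) with hN
  let X : Responses k → ℝ := fun ω => ∑ w, if Sink ω w then 1 else 0
  have hX : mean X = 1 := by
    simp only [X]
    rw [mean_sum]
    calc ∑ w : Profile k, mean (fun ω : Responses k => if Sink ω w then (1 : ℝ) else 0)
        = ∑ _w : Profile k, 1 / N := sum_congr rfl fun w _ => by
          rw [← prob_sink w, prob]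
      _ = 1 := by
        rw [sum_const, card_univ, nsmul_eq_mul, hcard]
        field_simp
  have hX2 : mean (fun ω => X ω * X ω) ≤ 2 := by
    have h1 : ∀ ω, X ω * X ω = ∑ p : Profile k × Profile k,
        if Sink ω p.1 ∧ Sink ω p.2 then 1 else 0 := by
      intro ω
      simp only [X]
      rw [sum_mul_sum, ← Fintype.sum_prod_type']
      refine sum_congr rfl fun p _ => ?_
      by_cases h1 : Sink ω p.1 <;> by_cases h2 : Sink ω p.2 <;> simp [h1, h2]
    simp only [h1]
    rw [mean_sum]
    calc ∑ p : Profile k × Profile k,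
          mean (fun ω : Responses k => if Sink ω p.1 ∧ Sink ω p.2 then (1 : ℝ) else 0)
        ≤ ∑ p : Profile k × Profile k, ((if p.1 = p.2 then 1 / N else 0) + (1 / N) ^ 2) := by
          refine sum_le_sum fun p _ => ?_
          have : mean (fun ω : Responses k => if Sink ω p.1 ∧ Sink ω p.2 then (1 : ℝ) else 0) =
              prob (fun ω : Responses k => Sink ω p.1 ∧ Sink ω p.2) := by
            rw [prob]; congr!
          rw [this]
          split_ifs with h
          · rw [← prob_sink p.1]
            have := prob_mono (E := fun ω : Responses k => Sink ω p.1 ∧ Sink ω p.2)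
              (F := fun ω => Sink ω p.1) fun ω h => h.1
            have h2 : 0 ≤ prob (fun ω : Responses k => Sink ω p.1) ^ 2 := by positivity
            linarith
          · rw [zero_add]
            exact prob_sink_and_sink_le h
      _ = 2 := by
          rw [sum_add_distrib, Fintype.sum_prod_type]
          simp only [sum_ite_eq, mem_univ, if_true, sum_const, card_univ, Fintype.card_prod,
            nsmul_eq_mul]
          push_cast
          rw [hcard]
          field_simp
          norm_num
  have hle : ∀ ω, 3 / 2 * X ω + (-1 / 2) * (X ω * X ω) ≤ if ∃ w, Sink ω w then 1 else 0 := by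
    intro ω
    have hXn : X ω = ((univ.filter fun w => Sink ω w).card : ℕ) := by simp [X]
    split_ifs with h
    · rw [hXn]
      generalize (univ.filter fun w => Sink ω w).card = x
      have h3 : (0 : ℝ) ≤ ((x : ℝ) - 1) * (x - 2) := by
        rcases Nat.lt_or_ge x 2 with h | h
        · have : (x : ℝ) ≤ 1 := by exact_mod_cast Nat.lt_succ_iff.1 h
          nlinarith
        · have : (2 : ℝ) ≤ x := by exact_mod_cast h
          nlinarith
      nlinarith
    · have : X ω = 0 := by
        simp only [X]
        exact sum_eq_zero fun w _ => if_neg fun hw => h ⟨w, hw⟩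
      rw [this]
      simp
  have h4 : mean (fun ω => 3 / 2 * X ω + (-1 / 2) * (X ω * X ω)) ≤
      prob (fun ω : Responses k => ∃ w, Sink ω w) := by
    rw [prob]
    refine mean_mono fun ω => (hle ω).trans (le_of_eq ?_)
    congr!
  rw [mean_add, mean_const_mul, mean_const_mul, hX] at h4
  linarith

end BestResponse

/-! ### From generic games to independent uniform replies. -/

namespace BestResponse

open Finset UniformProduct

variable {n : ℕ} {k : Fin n → ℕ} [∀ i, NeZero (k i)]

omit [∀ i, NeZero (k i)] in
theorem isBestResponse_update (g : OrdinalGame k) (i : Fin n) (x z : Fin (k i)) (a : Profile k) :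
    g.IsBestResponse i x (Function.update a i z) ↔ g.IsBestResponse i x a := by
  simp [OrdinalGame.IsBestResponse]

theorem exists_isBestResponse (g : OrdinalGame k) (i : Fin n) (a : Profile k) :
    ∃ x, g.IsBestResponse i x a := by
  suffices h : ∀ s : Finset (Fin (k i)), s.Nonempty → ∃ x ∈ s, ∀ y ∈ s,
      g.pref i (Function.update a i x) (Function.update a i y) by
    obtain ⟨x, -, hx⟩ := h univ univ_nonempty
    exact ⟨x, fun y => hx y (mem_univ y)⟩
  intro s hs
  induction hs using Finset.Nonempty.cons_induction with
  | singleton x =>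
    refine ⟨x, mem_singleton_self x, fun y hy => ?_⟩
    rw [mem_singleton.1 hy]
    exact (or_self_iff).1 (g.complete i _ _)
  | cons b s hb hs ih =>
    obtain ⟨x, hx, hmax⟩ := ih
    rcases g.complete i (Function.update a i x) (Function.update a i b) with h | h
    · refine ⟨x, mem_cons_of_mem hx, fun y hy => ?_⟩
      rcases mem_cons.1 hy with rfl | hy
      · exact h
      · exact hmax y hy
    · refine ⟨b, mem_cons_self _ _, fun y hy => ?_⟩
      rcases mem_cons.1 hy with rfl | hy
      · exact (or_self_iff).1 (g.complete i _ _)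
      · exact g.transitive i _ _ _ h (hmax y hy)

/-- A best response of player `i` at the profile `a`. -/
noncomputable def bestReply (g : OrdinalGame k) (i : Fin n) (a : Profile k) : Fin (k i) :=
  (exists_isBestResponse g i a).choose

/-- Genericity rules out ties on a line, so the chosen best reply is the only one. -/
theorem isBestResponse_iff {g : OrdinalGame k} (hg : g.IsGeneric) (i : Fin n) (x : Fin (k i))
    (a : Profile k) : g.IsBestResponse i x a ↔ bestReply g i a = x := by
  have hspec : g.IsBestResponse i (bestReply g i a) a := (exists_isBestResponse g i a).choose_spec
  refine ⟨fun h => ?_, fun h => h ▸ hspec⟩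
  by_contra hne
  rcases hg i (Function.update a i (bestReply g i a)) (Function.update a i x)
    (fun he => hne (by simpa using congrFun he i)) (fun j hj => by simp [hj]) with h' | h'
  · exact h'.2 (h _)
  · exact h'.2 (hspec _)

/-- The best responses of the players in the game `g`. -/
noncomputable def responses (g : OrdinalGame k) : Responses k := fun q => bestReply g q.1 q.2

theorem bestReply_update {g : OrdinalGame k} (hg : g.IsGeneric) (i : Fin n) (a : Profile k)
    (z : Fin (k i)) : bestReply g i (Function.update a i z) = bestReply g i a := by
  rw [← isBestResponse_iff hg, isBestResponse_update, isBestResponse_iff hg]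

theorem reply_responses {g : OrdinalGame k} (hg : g.IsGeneric) (i : Fin n) (a : Profile k) :
    reply (responses g) i a = bestReply g i a :=
  bestReply_update hg i a 0

theorem bestResponseGraph_adj_iff {g : OrdinalGame k} (hg : g.IsGeneric) (a b : Profile k) :
    g.bestResponseGraph.Adj a b ↔ Step (responses g) univ a b := by
  constructor
  · rintro ⟨i, hab, hbr, hstrict⟩
    rw [isBestResponse_iff hg, ← reply_responses hg] at hbr
    have hb : b = Function.update a i (b i) := by
      funext j
      by_cases hj : j = i
      · subst hj; simp
      · simp [hj, hab j hj]
    refine ⟨i, mem_univ i, fun h => ?_, by rwa [hbr]⟩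
    rw [← hbr, h, Function.update_eq_self] at hb
    rw [hb] at hstrict
    exact hstrict.2 hstrict.1
  · rintro ⟨i, -, hne, rfl⟩
    have hbr : g.IsBestResponse i (reply (responses g) i a) a := by
      rw [isBestResponse_iff hg, reply_responses hg]
    refine ⟨i, fun j hj => by simp [hj], by simpa using hbr, ?_⟩
    have hpref := hbr (a i)
    rw [Function.update_eq_self] at hpref
    rcases hg i (Function.update a i (reply (responses g) i a)) a
      (fun he => hne (by simpa using congrFun he i)) (fun j hj => by simp [hj]) with h | h
    · exact h
    · exact absurd hpref h.2

theorem isSink_iff {g : OrdinalGame k} (hg : g.IsGeneric) (a : Profile k) :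
    IsSink g.bestResponseGraph a ↔ Sink (responses g) a := by
  unfold IsSink
  simp only [bestResponseGraph_adj_iff hg]
  constructor
  · intro h i
    by_contra hne
    exact h _ ⟨i, mem_univ i, hne, rfl⟩
  · rintro h b ⟨i, -, hne, -⟩
    exact hne (h i)

theorem hasPureNash_iff {g : OrdinalGame k} (hg : g.IsGeneric) :
    g.HasPureNash ↔ ∃ a, Sink (responses g) a := by
  refine exists_congr fun a => forall_congr' fun i => ?_
  rw [isBestResponse_iff hg, reply_responses hg]

theorem isConnected_iff {g : OrdinalGame k} (hg : g.IsGeneric) :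
    g.IsConnected ↔ (∃ a, Sink (responses g) a) ∧
      ¬ ∃ w, Sink (responses g) w ∧ ∃ v, ¬ Sink (responses g) v ∧
        ¬ Reach (responses g) univ v w := by
  have hadj : g.bestResponseGraph.Adj = Step (responses g) univ := by
    funext a b
    exact propext (bestResponseGraph_adj_iff hg a b)
  unfold OrdinalGame.IsConnected CanReach
  simp only [isSink_iff hg, hadj]
  refine and_congr_right fun _ => ⟨?_, ?_⟩
  · rintro h ⟨w, hw, v, hv, hr⟩
    exact hr (h v w hv hw)
  · intro h v w hv hw
    by_contra hr
    exact h ⟨w, hw, v, hv, hr⟩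

/-- Cyclically shifting the actions of player `i` on every line. -/
def shiftProfile (σ : Responses k) (i : Fin n) (a : Profile k) : Profile k :=
  Function.update a i (a i + σ (line i a))

theorem shiftProfile_update (σ : Responses k) (i : Fin n) (a : Profile k) (x : Fin (k i)) :
    shiftProfile σ i (Function.update a i x) = Function.update a i (x + reply σ i a) := by
  have h : σ (line i (Function.update a i x)) = reply σ i a := reply_update σ i a x
  unfold shiftProfile
  rw [h]
  simp

theorem shiftProfile_neg (σ : Responses k) (i : Fin n) (a : Profile k) :
    shiftProfile σ i (shiftProfile (-σ) i a) = a := by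
  rw [show shiftProfile (-σ) i a = Function.update a i (a i + (-σ) (line i a)) from rfl,
    shiftProfile_update]
  simp [reply]

theorem shiftProfile_of_ne (σ : Responses k) {i j : Fin n} (hj : j ≠ i) (a : Profile k) :
    shiftProfile σ i a j = a j := by simp [shiftProfile, hj]

/-- The game obtained by cyclically shifting each player's actions on every line. -/
def shiftGame (σ : Responses k) (g : OrdinalGame k) : OrdinalGame k where
  pref i a b := g.pref i (shiftProfile σ i a) (shiftProfile σ i b)
  complete i _ _ := g.complete i _ _
  transitive i _ _ _ := g.transitive i _ _ _

theorem shiftGame_shiftGame_neg (σ : Responses k) (g : OrdinalGame k) :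
    shiftGame (-σ) (shiftGame σ g) = g := by
  ext i a b
  simp [shiftGame, shiftProfile_neg]

theorem isGeneric_shiftGame (σ : Responses k) {g : OrdinalGame k} (hg : g.IsGeneric) :
    (shiftGame σ g).IsGeneric := by
  intro i a b hab h
  refine hg i (shiftProfile σ i a) (shiftProfile σ i b) (fun he => hab ?_) fun j hj => ?_
  · have := congrArg (shiftProfile (-σ) i) he
    have h2 := shiftProfile_neg (-σ) i
    rw [neg_neg] at h2
    rwa [h2, h2] at this
  · rw [shiftProfile_of_ne σ hj, shiftProfile_of_ne σ hj, h j hj]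

/-- Relabelling by σ translates each best reply by -σ; averaging over all σ therefore makes the
replies uniform, whatever the game. -/
theorem reply_responses_shiftGame (σ : Responses k) {g : OrdinalGame k} (hg : g.IsGeneric)
    (i : Fin n) (a : Profile k) :
    reply (responses (shiftGame σ g)) i a = reply (responses g - σ) i a := by
  rw [reply_responses (isGeneric_shiftGame σ hg), ← isBestResponse_iff (isGeneric_shiftGame σ hg)]
  have h : reply (responses g - σ) i a = bestReply g i a - reply σ i a := by
    rw [← reply_responses hg]
    rfl
  have hbr : g.IsBestResponse i (bestReply g i a) a := (isBestResponse_iff hg i _ a).2 rfl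
  intro y
  change g.pref i (shiftProfile σ i _) (shiftProfile σ i _)
  rw [shiftProfile_update, shiftProfile_update, h, sub_add_cancel]
  exact hbr _

/-- Shifting as a permutation of the generic games. -/
def shiftEquiv (σ : Responses k) :
    {g : OrdinalGame k // g.IsGeneric} ≃ {g : OrdinalGame k // g.IsGeneric} where
  toFun g := ⟨shiftGame σ g.1, isGeneric_shiftGame σ g.2⟩
  invFun g := ⟨shiftGame (-σ) g.1, isGeneric_shiftGame (-σ) g.2⟩
  left_inv g := Subtype.ext (shiftGame_shiftGame_neg σ g.1)
  right_inv g := Subtype.ext (by simpa using shiftGame_shiftGame_neg (-σ) g.1)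

-- Needed so that the ratio of counts is not 0/0; one linear order shared by all players is generic.
omit [∀ i, NeZero (k i)] in
theorem exists_isGeneric : ∃ g : OrdinalGame k, g.IsGeneric := by
  let e := Fintype.equivFin (Profile k)
  refine ⟨⟨fun _ a b => e b ≤ e a, fun _ a b => le_total _ _, fun _ a b c h h' => h'.trans h⟩, ?_⟩
  intro i a b hab _
  rcases lt_or_gt_of_ne (e.injective.ne hab) with h | h
  · exact Or.inr ⟨h.le, not_le.2 h⟩
  · exact Or.inl ⟨h.le, not_le.2 h⟩

/-- The best responses of a uniformly random generic game are uniformly distributed. -/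
theorem ncard_isGeneric_and (P : Responses k → Prop)
    (hP : ∀ ω ω', (∀ i a, reply ω i a = reply ω' i a) → P ω → P ω') :
    ({g : OrdinalGame k | g.IsGeneric ∧ P (responses g)}.ncard : ℝ) =
      ({g : OrdinalGame k | g.IsGeneric}.ncard : ℝ) * prob P := by
  classical
  let G := {g : OrdinalGame k // g.IsGeneric}
  have : Fintype G := Fintype.ofFinite G
  have hshift : ∀ (σ : Responses k) (g : G),
      P (responses (shiftEquiv σ g).1) ↔ P (responses g.1 - σ) := fun σ g =>
    ⟨hP _ _ fun i a => reply_responses_shiftGame σ g.2 i a,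
      hP _ _ fun i a => (reply_responses_shiftGame σ g.2 i a).symm⟩
  -- Double counting of pairs (σ, g): for fixed σ shifting permutes the games, and for fixed `g` the
  -- map σ ↦ `responses g - σ` permutes the responses.
  have key : (Fintype.card (Responses k) : ℝ) * (∑ g : G, if P (responses g.1) then (1 : ℝ) else 0)
      = Fintype.card G * ∑ ω : Responses k, if P ω then (1 : ℝ) else 0 := by
    calc _ = ∑ _σ : Responses k, ∑ g : G, if P (responses g.1) then (1 : ℝ) else 0 := by simp
      _ = ∑ σ : Responses k, ∑ g : G, if P (responses g.1 - σ) then (1 : ℝ) else 0 := by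
        refine sum_congr rfl fun σ _ => ?_
        rw [← (shiftEquiv σ).sum_comp]
        refine sum_congr rfl fun g _ => ?_
        simp only [hshift]
      _ = ∑ g : G, ∑ σ : Responses k, if P (responses g.1 - σ) then (1 : ℝ) else 0 := sum_comm
      _ = ∑ _g : G, ∑ ω : Responses k, if P ω then (1 : ℝ) else 0 :=
        sum_congr rfl fun g _ =>
          (Equiv.subLeft (responses g.1)).sum_comp fun ω => if P ω then (1 : ℝ) else 0
      _ = _ := by simp
  have h1 : ({g : OrdinalGame k | g.IsGeneric ∧ P (responses g)}.ncard : ℝ) =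
      ∑ g : G, if P (responses g.1) then (1 : ℝ) else 0 := by
    have : {g : OrdinalGame k | g.IsGeneric ∧ P (responses g)} =
        Subtype.val '' {g : G | P (responses g.1)} := by
      ext g
      constructor
      · rintro ⟨hg, h⟩
        exact ⟨⟨g, hg⟩, h, rfl⟩
      · rintro ⟨g, h, rfl⟩
        exact ⟨g.2, h⟩
    rw [this, Set.ncard_image_of_injective _ Subtype.val_injective, Finset.sum_boole,
      ← Set.ncard_coe_finset]
    simp
  have h2 : ({g : OrdinalGame k | g.IsGeneric}.ncard : ℝ) = Fintype.card G := by
    rw [← Nat.card_coe_set_eq, ← Nat.card_eq_fintype_card]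
    rfl
  have hcard : (Fintype.card (Responses k) : ℝ) ≠ 0 := by exact_mod_cast Fintype.card_ne_zero
  rw [h1, h2]
  have h3 : prob P = (∑ ω : Responses k, if P ω then (1 : ℝ) else 0) / Fintype.card (Responses k) := by
    unfold prob mean
    congr!
  rw [h3]
  field_simp
  linarith

theorem step_of_reply_eq {ω ω' : Responses k}
    (h : ∀ i a, reply ω i a = reply ω' i a) : Step ω = Step ω' := by
  funext J a b
  simp only [Step, h]

/-- The fraction of games with a pure Nash equilibrium that are connected, in terms of uniformly
random best responses. -/
theorem ncard_isConnected_div_ge {c : ℝ}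
    (hc : prob (fun ω : Responses k => ∃ w, Sink ω w ∧ ∃ v, ¬ Sink ω v ∧ ¬ Reach ω univ v w) ≤ c) :
    1 - 2 * c ≤ ({g : OrdinalGame k | g.IsGeneric ∧ g.IsConnected}.ncard : ℝ) /
      ({g : OrdinalGame k | g.IsGeneric ∧ g.HasPureNash}.ncard : ℝ) := by
  let P : Responses k → Prop := fun ω => ∃ a, Sink ω a
  let B : Responses k → Prop := fun ω => ∃ w, Sink ω w ∧ ∃ v, ¬ Sink ω v ∧ ¬ Reach ω univ v w
  have hsink : ∀ ω ω' : Responses k, (∀ i a, reply ω i a = reply ω' i a) → Sink ω = Sink ω' := by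
    intro ω ω' h
    funext w
    simp only [Sink, h]
  have hP : {g : OrdinalGame k | g.IsGeneric ∧ g.HasPureNash} =
      {g : OrdinalGame k | g.IsGeneric ∧ P (responses g)} :=
    Set.ext fun g => and_congr_right fun hg => hasPureNash_iff hg
  have hC : {g : OrdinalGame k | g.IsGeneric ∧ g.IsConnected} =
      {g : OrdinalGame k | g.IsGeneric ∧ (P (responses g) ∧ ¬ B (responses g))} :=
    Set.ext fun g => and_congr_right fun hg => isConnected_iff hg
  rw [hP, hC, ncard_isGeneric_and P, ncard_isGeneric_and fun ω => P ω ∧ ¬ B ω]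
  · have hG : (0 : ℝ) < ({g : OrdinalGame k | g.IsGeneric}.ncard : ℝ) := by
      exact_mod_cast (Set.ncard_pos (Set.toFinite _)).2 exists_isGeneric
    have hhalf : 1 / 2 ≤ prob P := half_le_prob_exists_sink
    rw [mul_div_mul_left _ _ hG.ne', le_div_iff₀ (by linarith)]
    have h1 := prob_and_add_and_not P B
    have h2 : prob (fun ω => P ω ∧ B ω) ≤ c := (prob_mono fun ω h => h.2).trans hc
    have h3 := prob_nonneg B
    have h4 : 0 ≤ c := h3.trans hc
    nlinarith
  · intro ω ω' h
    have hs := hsink ω ω' h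
    have hr : Reach ω = Reach ω' := by
      unfold Reach
      rw [step_of_reply_eq h]
    simp only [P, B, hs, hr]
    exact id
  · intro ω ω' h
    simp only [P, hsink ω ω' h]
    exact id

end BestResponse

/-! ### Choice of parameters and numerical estimates. -/

namespace BestResponse

open Finset UniformProduct

theorem half_le_exp : (1 / 2 : ℝ) ≤ Real.exp (-(6 / 10)) := by
  rw [Real.exp_neg, one_div]
  refine inv_anti₀ (by positivity) ?_
  have := Real.log_two_gt_d9
  calc Real.exp (6 / 10) ≤ Real.exp (Real.log 2) := by gcongr; linarith
    _ = 2 := Real.exp_log (by norm_num)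

theorem mul_one_sub_pow_le_half {κ t s : ℕ} {ℓ : ℝ} (hκ : (0 : ℝ) < κ) (hℓ : 1 ≤ ℓ)
    (ht : (t : ℝ) ≤ Real.exp ℓ / 2) (hs : 3 * (κ * ℓ) ≤ s) :
    t * (1 - 1 / (κ : ℝ)) ^ s ≤ 1 / 2 := by
  have e1 : (1 - 1 / (κ : ℝ)) ^ s ≤ Real.exp (-(3 * ℓ)) := by
    have e : 1 - 1 / (κ : ℝ) ≤ Real.exp (-(1 / κ)) := by
      linarith [Real.add_one_le_exp (-(1 / (κ : ℝ)))]
    calc (1 - 1 / (κ : ℝ)) ^ s ≤ Real.exp (-(1 / κ)) ^ s :=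
          pow_le_pow_left₀ one_sub_one_div_nonneg e s
      _ = Real.exp (-(s / κ)) := by rw [← Real.exp_nat_mul]; congr 1; ring
      _ ≤ _ := by
        have : 3 * ℓ ≤ s / κ := by
          rw [le_div_iff₀ hκ]
          linarith
        gcongr
  calc (t : ℝ) * (1 - 1 / (κ : ℝ)) ^ s ≤ Real.exp ℓ / 2 * Real.exp (-(3 * ℓ)) :=
        mul_le_mul ht e1 (pow_nonneg one_sub_one_div_nonneg _) (by positivity)
    _ = Real.exp (-(2 * ℓ)) / 2 := by
      rw [div_mul_eq_mul_div, ← Real.exp_add]; ring_nf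
    _ ≤ 1 / 2 := by
      have : Real.exp (-(2 * ℓ)) ≤ 1 := Real.exp_le_one_iff.2 (by linarith)
      linarith

theorem mul_half_pow_pow_le {n t s d : ℕ} {ℓ : ℝ} (hℓ : 1 ≤ ℓ) (ht : (t : ℝ) ≤ Real.exp ℓ)
    (hs : 1000 * ℓ ^ 2 ≤ s) (hd : (n : ℝ) / 2 ≤ d * (128 * ℓ)) :
    (t * (1 / 2 : ℝ) ^ s) ^ d ≤ Real.exp (-(2 * n * ℓ)) := by
  have hℓ2 : ℓ ≤ ℓ ^ 2 := by nlinarith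
  have hd' := mul_le_mul_of_nonneg_right hd (show 0 ≤ 4 * ℓ by linarith)
  have e2 : (t : ℝ) * (1 / 2 : ℝ) ^ s ≤ Real.exp (-(512 * ℓ ^ 2)) := by
    calc (t : ℝ) * (1 / 2 : ℝ) ^ s ≤ Real.exp ℓ * Real.exp (-(6 / 10)) ^ s := by
          gcongr
          exact half_le_exp
      _ = Real.exp (ℓ + s * (-(6 / 10))) := by rw [← Real.exp_nat_mul, ← Real.exp_add]
      _ ≤ _ := by
        gcongr
        linarith
  calc _ ≤ Real.exp (-(512 * ℓ ^ 2)) ^ d := by gcongr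
    _ = Real.exp (d * -(512 * ℓ ^ 2)) := by rw [← Real.exp_nat_mul]
    _ ≤ _ := by
      gcongr
      linarith

/-- Since 18² < 2^9, the factor 2^(9κ) absorbs the squared descent probability, and 2^L ≥ n makes
the remaining 2^(2L+1) at least 2n² ≥ 2nℓ. -/
theorem one_sub_pow_le {n κ L : ℕ} {ℓ : ℝ} (hexpℓ : Real.exp ℓ = n) (hL : 2 * ℓ ≤ L) :
    (1 - ((1 / 18 : ℝ) ^ κ) ^ 2) ^ 2 ^ (9 * κ + 2 * L + 1) ≤ Real.exp (-(2 * n * ℓ)) := by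
  obtain ⟨p, hp⟩ : ∃ p : ℝ, p = ((1 / 18 : ℝ) ^ κ) ^ 2 := ⟨_, rfl⟩
  rw [← hp]
  have hp1 : p ≤ 1 := by
    rw [hp]
    exact pow_le_one₀ (by positivity) (pow_le_one₀ (by norm_num) (by norm_num))
  have e1 : 1 - p ≤ Real.exp (-p) := by linarith [Real.add_one_le_exp (-p)]
  have e2 : (1 / 2 ^ 9 : ℝ) ^ κ ≤ p := by
    rw [hp, ← pow_mul, mul_comm κ 2, pow_mul]
    gcongr
    norm_num
  have hℓn : ℓ ≤ n := by
    rw [← hexpℓ]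
    linarith [Real.add_one_le_exp ℓ]
  have e3 : (n : ℝ) ≤ 2 ^ L := by
    have e4 : Real.exp ℓ ≤ Real.exp (Real.log 2 * L) := by
      have := Real.log_two_gt_d9
      have hL0 : (0 : ℝ) ≤ L := Nat.cast_nonneg L
      gcongr
      nlinarith
    rwa [hexpℓ, mul_comm, Real.exp_nat_mul, Real.exp_log (by norm_num)] at e4
  have e5 : 2 * n * ℓ ≤ (2 ^ (9 * κ + 2 * L + 1) : ℝ) * p := by
    have e6 : (2 : ℝ) ^ (9 * κ) * (1 / 2 ^ 9) ^ κ = 1 := by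
      rw [pow_mul, ← mul_pow]
      norm_num
    calc 2 * n * ℓ ≤ 2 * n * n := by gcongr
      _ ≤ 2 * 2 ^ L * 2 ^ L := by gcongr
      _ = (2 ^ (9 * κ) * (1 / 2 ^ 9) ^ κ) * (2 * 2 ^ L * 2 ^ L) := by rw [e6, one_mul]
      _ = 2 ^ (9 * κ + 2 * L + 1) * (1 / 2 ^ 9) ^ κ := by
        ring
      _ ≤ _ := by gcongr
  calc _ ≤ Real.exp (-p) ^ (2 ^ (9 * κ + 2 * L + 1)) :=
        pow_le_pow_left₀ (by linarith) e1 _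
    _ = Real.exp (((2 ^ (9 * κ + 2 * L + 1) : ℕ) : ℝ) * -p) := by rw [← Real.exp_nat_mul]
    _ ≤ _ := by
      push_cast
      gcongr
      linarith

/-- With t of order κ + ℓ and s about n/(4t), backward growth needs s ≥ 3κℓ and forward
amplification needs s ≥ 1000ℓ²; the size hypotheses supply both. The value d ≈ n/(128ℓ) keeps
n^(16d+4) below e^(n/4), yet is large enough for the forward failure to beat n^n. -/
theorem exists_parameters {n κ : ℕ} {ℓ : ℝ} (hexpℓ : Real.exp ℓ = n) (hκ : 2 ≤ κ)
    (hℓ : 1 ≤ ℓ)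
    (h0 : 10 ^ 6 * ℓ ^ 3 ≤ n) (h1 : 10 ^ 6 * (κ ^ 2 * ℓ) ≤ n)
    (h2 : 10 ^ 6 * (κ * ℓ ^ 2) ≤ n) :
    ∃ t s d M : ℕ, t * s ≤ n / 4 ∧ 4 * d ≤ n ∧ 2 * (M + 1) ≤ 2 ^ t ∧
      t * (1 - 1 / (κ : ℝ)) ^ s ≤ 1 / 2 ∧ (n : ℝ) ^ (16 * d + 4) ≤ Real.exp (n / 4) ∧
      (t * (1 / 2 : ℝ) ^ s) ^ d ≤ Real.exp (-(2 * n * ℓ)) ∧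
      (1 - ((1 / 18 : ℝ) ^ κ) ^ 2) ^ M ≤ Real.exp (-(2 * n * ℓ)) := by
  have hκ0 : (2 : ℝ) ≤ κ := by exact_mod_cast hκ
  have hℓ2 : ℓ ≤ ℓ ^ 2 := by nlinarith
  have hℓ3 : ℓ ^ 2 ≤ ℓ ^ 3 := by nlinarith [sq_nonneg ℓ]
  have hn6 : (10 : ℝ) ^ 6 ≤ n := by nlinarith
  have hnpos : (0 : ℝ) < n := by linarith
  have hκn : 10 ^ 6 * (κ : ℝ) ≤ n := by nlinarith
  have hℓn : 10 ^ 6 * ℓ ≤ n := by linarith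
  obtain ⟨L, hL⟩ : ∃ L, L = ⌈2 * ℓ⌉₊ := ⟨_, rfl⟩
  have hL1 : 2 * ℓ ≤ L := hL ▸ Nat.le_ceil _
  have hL2 : (L : ℝ) < 2 * ℓ + 1 := hL ▸ Nat.ceil_lt_add_one (by linarith)
  -- Two more than the exponent of `M`, so that half of 2^t still exceeds `M`.
  obtain ⟨t, ht⟩ : ∃ t, t = 9 * κ + 2 * L + 3 := ⟨_, rfl⟩
  have htle : (t : ℝ) ≤ 12 * (κ + ℓ) := by
    rw [ht]; push_cast; linarith
  have htpos : (0 : ℝ) < t := by rw [ht]; push_cast; positivity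
  have ht0 : 0 < t := by omega
  obtain ⟨s, hs⟩ : ∃ s, s = n / 4 / t := ⟨_, rfl⟩
  obtain ⟨d, hd⟩ : ∃ d, d = ⌊(n : ℝ) / (128 * ℓ)⌋₊ := ⟨_, rfl⟩
  have hd1 : (d : ℝ) ≤ n / (128 * ℓ) := hd ▸ Nat.floor_le (by positivity)
  have hd2 : (n : ℝ) / (128 * ℓ) - 1 < d := by
    have := Nat.lt_floor_add_one ((n : ℝ) / (128 * ℓ))
    rw [← hd] at this
    linarith
  have hdℓ : (d : ℝ) * (128 * ℓ) ≤ n := by rwa [le_div_iff₀ (by positivity)] at hd1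
  have hdℓ2 : (n : ℝ) / 2 ≤ d * (128 * ℓ) := by
    have : (n : ℝ) < (d + 1) * (128 * ℓ) := by
      rw [← div_lt_iff₀ (by positivity)]
      linarith
    linarith
  have hs1 : (n : ℝ) ≤ 4 * t * (s + 2) := by
    have e1 : n < 4 * (n / 4 + 1) := by omega
    have e2 : n / 4 < t * (s + 1) := hs ▸ Nat.lt_mul_div_succ _ ht0
    have e3 : n ≤ 4 * t * (s + 2) := by nlinarith
    exact_mod_cast e3
  have hs2 : (n : ℝ) ≤ 48 * (κ + ℓ) * (s + 2) := by
    have : (4 * t * (s + 2) : ℝ) ≤ 48 * (κ + ℓ) * (s + 2) := by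
      have : (0 : ℝ) ≤ s + 2 := by positivity
      nlinarith
    linarith
  have hκℓ : 0 < (κ : ℝ) + ℓ := by linarith
  have hκℓ2 : 2 ≤ (κ : ℝ) * ℓ := by nlinarith
  have hsκ : 3 * (κ * ℓ) ≤ s := by
    have e : 10 ^ 6 * ((κ + ℓ) * (κ * ℓ)) ≤ 2 * (n : ℝ) := by
      have : ((κ : ℝ) + ℓ) * (κ * ℓ) = κ ^ 2 * ℓ + κ * ℓ ^ 2 := by ring
      linarith
    have e2 : (κ + ℓ) * (10 ^ 6 * (κ * ℓ)) ≤ (κ + ℓ) * (96 * (s + 2 : ℝ)) := by linarith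
    have e3 := le_of_mul_le_mul_left e2 hκℓ
    linarith
  have hsℓ : 1000 * ℓ ^ 2 ≤ s := by
    have e : 10 ^ 6 * ((κ + ℓ) * ℓ ^ 2) ≤ 2 * (n : ℝ) := by
      have : ((κ : ℝ) + ℓ) * ℓ ^ 2 = κ * ℓ ^ 2 + ℓ ^ 3 := by ring
      linarith
    have e2 : (κ + ℓ) * (10 ^ 6 * ℓ ^ 2) ≤ (κ + ℓ) * (96 * (s + 2 : ℝ)) := by linarith
    have e3 := le_of_mul_le_mul_left e2 hκℓ
    linarith
  have htn : 2 * (t : ℝ) ≤ n := by linarith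
  have htexp : (t : ℝ) ≤ Real.exp ℓ / 2 := by rw [hexpℓ]; linarith
  refine ⟨t, s, d, 2 ^ (9 * κ + 2 * L + 1), hs ▸ Nat.mul_div_le _ _, ?_, ?_, ?_, ?_, ?_, ?_⟩
  · have : (4 * d : ℝ) ≤ n := by
      have : (d : ℝ) ≤ d * ℓ := le_mul_of_one_le_right (Nat.cast_nonneg d) hℓ
      linarith
    exact_mod_cast this
  · have e : 1 ≤ 2 ^ (9 * κ + 2 * L + 1) := Nat.one_le_two_pow
    rw [ht, show 9 * κ + 2 * L + 3 = 9 * κ + 2 * L + 1 + 2 by ring, pow_add _ _ 2]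
    omega
  · exact mul_one_sub_pow_le_half (by linarith) hℓ htexp hsκ
  · rw [← hexpℓ, ← Real.exp_nat_mul, hexpℓ]
    have : ((16 * d + 4 : ℕ) : ℝ) * ℓ ≤ n / 4 := by
      push_cast
      linarith
    gcongr
  · exact mul_half_pow_pow_le hℓ (htexp.trans (by linarith [Real.exp_pos ℓ])) hsℓ hdℓ2
  · exact one_sub_pow_le hexpℓ hL1

theorem div_four_le_card_filter_mod (n : ℕ) (r : Fin 4) :
    n / 4 ≤ (univ.filter fun i : Fin n => Fin.ofNat 4 i = r).card := by
  have hlt : ∀ j ∈ range (n / 4), 4 * j + r < n := fun j hj => by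
    have := mem_range.1 hj
    omega
  calc n / 4 = (range (n / 4)).attach.card := by simp
    _ ≤ _ := by
      refine card_le_card_of_injOn (fun j => ⟨4 * j.1 + r, hlt j.1 j.2⟩) ?_ ?_
      · intro j _
        simp only [coe_filter, mem_univ, true_and, Set.mem_ofPred_eq]
        apply Fin.ext
        simp only [Fin.ofNat]
        omega
      · intro j _ j' _ h
        have := congrArg Fin.val h
        simp only at this
        exact Subtype.ext (by omega)

theorem prob_exists_sink_not_reach_le_exp {n κ : ℕ} {k : Fin n → ℕ} [∀ i, NeZero (k i)]
    (hk : ∀ i, 2 ≤ k i) (hkκ : ∀ i, k i ≤ κ) (hκ : 2 ≤ κ) (hℓ : 1 ≤ Real.log n)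
    (h0 : 10 ^ 6 * Real.log n ^ 3 ≤ n) (h1 : 10 ^ 6 * (κ ^ 2 * Real.log n) ≤ n)
    (h2 : 10 ^ 6 * (κ * Real.log n ^ 2) ≤ n) :
    2 * prob (fun ω : Responses k => ∃ w, Sink ω w ∧ ∃ v, ¬ Sink ω v ∧ ¬ Reach ω univ v w) ≤
      Real.exp (-(1 / 10 * n)) := by
  have hκ0 : (2 : ℝ) ≤ κ := by exact_mod_cast hκ
  have hℓ3 : 1 ≤ Real.log n ^ 3 := one_le_pow₀ hℓ
  have hn6 : (10 : ℝ) ^ 6 ≤ n := by linarith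
  have hnpos : (0 : ℝ) < n := by linarith
  have hκn : (κ : ℝ) ≤ n := by nlinarith
  obtain ⟨t, s, d, M, hts, hd, hM, hq, hA, hF, hC⟩ := exists_parameters (Real.exp_log hnpos) hκ hℓ h0 h1 h2
  have hbound := prob_exists_sink_not_reach_le fun w =>
    prob_exists_not_reach_near_le hk (by omega) hkκ w (fun i : Fin n => Fin.ofNat 4 i)
      (div_four_le_card_filter_mod n) hts hd hM hq
  set N : ℝ := ∏ i, (k i : ℝ) with hN
  have hlog2 := Real.log_two_gt_d9
  have hN2 : Real.exp (n / 2) ≤ N := by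
    calc Real.exp (n / 2) ≤ Real.exp (n * Real.log 2) := by gcongr; nlinarith
      _ = ∏ _i : Fin n, (2 : ℝ) := by
        rw [Real.exp_nat_mul, Real.exp_log (by norm_num)]; simp
      _ ≤ N := prod_le_prod (fun _ _ => by norm_num) fun i _ => by exact_mod_cast hk i
  have hNn : N ≤ Real.exp (n * Real.log n) := by
    calc N ≤ ∏ _i : Fin n, (n : ℝ) := prod_le_prod (fun _ _ => by positivity) fun i _ =>
          le_trans (by exact_mod_cast hkκ i) hκn
      _ = _ := by rw [Real.exp_nat_mul, Real.exp_log hnpos]; simp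
  have hNpos : 0 < N := (Real.exp_pos _).trans_le hN2
  have b1 : (n : ℝ) ^ (8 * d + 1) * κ ^ (8 * d + 3) / N ≤ Real.exp (-(n / 8)) := by
    rw [div_le_iff₀ hNpos]
    calc (n : ℝ) ^ (8 * d + 1) * κ ^ (8 * d + 3) ≤ n ^ (8 * d + 1) * n ^ (8 * d + 3) := by gcongr
      _ = n ^ (16 * d + 4) := by rw [← pow_add]; congr 1; ring
      _ ≤ Real.exp (n / 4) := hA
      _ ≤ Real.exp (-(n / 8) + n / 2) := by gcongr; linarith
      _ = Real.exp (-(n / 8)) * Real.exp (n / 2) := Real.exp_add _ _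
      _ ≤ _ := by gcongr
  have b2 : 4 * (1 / 2 : ℝ) ^ (n / 4) ≤ 12 * Real.exp (-(n / 8)) := by
    have e2 : (n : ℝ) ≤ 4 * ((n / 4 : ℕ) + 1) := by
      have : n ≤ 4 * (n / 4 + 1) := by omega
      exact_mod_cast this
    have e3 : (1 / 2 : ℝ) ^ (n / 4) ≤ 3 * Real.exp (-(n / 8)) := by
      calc (1 / 2 : ℝ) ^ (n / 4) ≤ Real.exp (-(6 / 10)) ^ (n / 4) := by gcongr; exact half_le_exp
        _ = Real.exp ((n / 4 : ℕ) * -(6 / 10)) := by rw [← Real.exp_nat_mul]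
        _ ≤ Real.exp (1 + -(n / 8)) := by gcongr; linarith
        _ = Real.exp 1 * Real.exp (-(n / 8)) := Real.exp_add _ _
        _ ≤ _ := by
          have := Real.exp_one_lt_d9
          gcongr
          linarith
    linarith
  have b3 : 4 * N * ((t * (1 / 2 : ℝ) ^ s) ^ d + (1 - ((1 / 18 : ℝ) ^ κ) ^ 2) ^ M) ≤
      8 * Real.exp (-(n / 8)) := by
    have hsum : (0 : ℝ) ≤ (t * (1 / 2 : ℝ) ^ s) ^ d + (1 - ((1 / 18 : ℝ) ^ κ) ^ 2) ^ M := by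
      have e : ((1 / 18 : ℝ) ^ κ) ^ 2 ≤ 1 :=
        pow_le_one₀ (by positivity) (pow_le_one₀ (by norm_num) (by norm_num))
      have e2 : (0 : ℝ) ≤ (t * (1 / 2 : ℝ) ^ s) ^ d := by positivity
      linarith [pow_nonneg (sub_nonneg.2 e) M]
    calc 4 * N * ((t * (1 / 2 : ℝ) ^ s) ^ d + (1 - ((1 / 18 : ℝ) ^ κ) ^ 2) ^ M)
      _ ≤ 4 * Real.exp (n * Real.log n) * (Real.exp (-(2 * n * Real.log n)) +
          Real.exp (-(2 * n * Real.log n))) :=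
        mul_le_mul (mul_le_mul_of_nonneg_left hNn (by norm_num)) (add_le_add hF hC) hsum
          (by positivity)
      _ = 8 * Real.exp (n * Real.log n + -(2 * n * Real.log n)) := by rw [Real.exp_add]; ring
      _ ≤ _ := by
        gcongr
        nlinarith
  -- The constant is 2 · (1 + 12 + 8), collecting the three preceding bounds.
  have b4 : 42 * Real.exp (-((n : ℝ) / 8)) ≤ Real.exp (-(1 / 10 * n)) := by
    have e1 : (42 : ℝ) ≤ Real.exp (n / 40) := by
      linarith [Real.add_one_le_exp ((n : ℝ) / 40)]
    calc 42 * Real.exp (-((n : ℝ) / 8)) ≤ Real.exp (n / 40) * Real.exp (-((n : ℝ) / 8)) := by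
          gcongr
      _ = _ := by rw [← Real.exp_add]; congr 1; ring
  linarith

theorem exists_forall_log_pow_three_le :
    ∃ R : ℝ, 3 ≤ R ∧ ∀ x, R ≤ x → 10 ^ 6 * Real.log x ^ 3 ≤ x := by
  have h := (Real.isLittleO_pow_log_id_atTop (n := 3)).def (c := 1 / 10 ^ 6) (by norm_num)
  obtain ⟨R, hR⟩ := Filter.eventually_atTop.1 h
  refine ⟨max R 3, le_max_right _ _, fun x hx => ?_⟩
  have hx3 : 3 ≤ x := (le_max_right _ _).trans hx
  have := hR x ((le_max_left _ _).trans hx)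
  have hlog : 0 ≤ Real.log x := Real.log_nonneg (by linarith)
  rw [id, Real.norm_of_nonneg (by positivity), Real.norm_of_nonneg (by linarith)] at this
  linarith

/-- Because κ ≥ 2, a small enough δ already forces `n` to be large, so small `n` satisfy the theorem
vacuously. -/
theorem le_of_le_mul_sqrt {R : ℝ} (hR : 3 ≤ R) {n κ : ℕ} (hn : 2 ≤ n) (hκ : 2 ≤ κ)
    (h : (κ : ℝ) ≤ 1 / (1000 * R) * Real.sqrt ((n : ℝ) / Real.log n)) :
    R ≤ n ∧ 10 ^ 6 * (κ ^ 2 * Real.log n) ≤ n := by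
  have hn' : (2 : ℝ) ≤ n := by exact_mod_cast hn
  have hκ' : (2 : ℝ) ≤ κ := by exact_mod_cast hκ
  have hlog : 1 / 2 < Real.log n := by
    have := Real.log_two_gt_d9
    have := Real.log_le_log (by norm_num) hn'
    linarith
  have hsq : (κ : ℝ) ^ 2 ≤ (1 / (1000 * R)) ^ 2 * (n / Real.log n) := by
    rw [← Real.sq_sqrt (show 0 ≤ (n : ℝ) / Real.log n by positivity), ← mul_pow]
    gcongr
  have hmain : 10 ^ 6 * R ^ 2 * (κ ^ 2 * Real.log n) ≤ n := by
    have e : (1 / (1000 * R)) ^ 2 * (n / Real.log n) = n / (10 ^ 6 * R ^ 2 * Real.log n) := by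
      field_simp
      norm_num
    rw [e, le_div_iff₀ (by positivity)] at hsq
    linarith
  have h4 : (4 : ℝ) ≤ κ ^ 2 := by nlinarith
  have h2 : 2 ≤ (κ : ℝ) ^ 2 * Real.log n := by nlinarith
  have hR2 : R ≤ R ^ 2 := by nlinarith
  constructor
  · nlinarith
  · nlinarith

end BestResponse

open BestResponse in
theorem theorem1 :
    ∃ c > (0 : ℝ), ∃ δ > (0 : ℝ), ∀ n : ℕ, 2 ≤ n → ∀ k : Fin n → ℕ, (∀ i, 2 ≤ k i) →
      ((Finset.univ.sup k : ℕ) : ℝ) ≤ δ * Real.sqrt ((n : ℝ) / Real.log (n : ℝ)) →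
      (({g : OrdinalGame k | g.IsGeneric ∧ g.IsConnected}.ncard : ℕ) : ℝ) /
          (({g : OrdinalGame k | g.IsGeneric ∧ g.HasPureNash}.ncard : ℕ) : ℝ)
        ≥ 1 - Real.exp (-(c * (n : ℝ))) := by
  obtain ⟨R, hR3, hR⟩ := exists_forall_log_pow_three_le
  refine ⟨1 / 10, by norm_num, 1 / (1000 * R), by positivity, fun n hn k hk hsup => ?_⟩
  have : ∀ i, NeZero (k i) := fun i => ⟨by have := hk i; omega⟩
  have hkκ : ∀ i, k i ≤ Finset.univ.sup k := fun i => Finset.le_sup (Finset.mem_univ i)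
  have hκ : 2 ≤ Finset.univ.sup k := (hk ⟨0, by omega⟩).trans (hkκ _)
  generalize Finset.univ.sup k = κ at hsup hkκ hκ
  obtain ⟨hRn, h1⟩ := le_of_le_mul_sqrt hR3 hn hκ hsup
  have h0 := hR n hRn
  have hℓ : 1 ≤ Real.log n := by
    rw [Real.le_log_iff_exp_le (by linarith)]
    linarith [Real.exp_one_lt_d9]
  have h2 : (10 : ℝ) ^ 6 * (κ * Real.log n ^ 2) ≤ n := by
    -- The quantity is the geometric mean of those bounded in `h1` and `h0`.
    refine abs_le_of_sq_le_sq' ?_ (by linarith) |>.2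
    calc ((10 : ℝ) ^ 6 * ((κ : ℝ) * Real.log n ^ 2)) ^ 2 =
          (10 ^ 6 * (κ ^ 2 * Real.log n)) * (10 ^ 6 * Real.log n ^ 3) := by ring
      _ ≤ (n : ℝ) * n := by gcongr
      _ = _ := by ring
  have hprob := prob_exists_sink_not_reach_le_exp hk hkκ hκ hℓ h0 h1 h2
  exact le_trans (by linarith) (ncard_isConnected_div_ge le_rfl)
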